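/- Let $\beta\neq0$, let $(\beta_p)_{p\ge2}$ be real numbers that are not all zero, and let $h\ge0$. Put $\xi(t)=\beta^2\sum_{p\ge2}\beta_p^2t^p$ and assume $\xi(1+\epsilon)<\infty$ for some $\epsilon>0$. For a Borel probability measure $\mu$ on $[0,1]$ let $\phi_\mu(t)=\int_t^1\mu([0,s])\,ds$ and $$P(\mu)=\frac12\left(\int_0^1\xi''\phi_\mu\,ds+\int_0^1\Big(\frac1{\phi_\mu(s)}-\frac1{1-s}\Big)ds+h^2\phi_\mu(0)\right)\in[0,\infty].$$ Let $\Lambda$ be the set of all $\eta\in C^1([0,1))$ such that $\eta'$ is locally Lipschitz on $[0,1)$, $\eta\ge\xi$ on $[0,1)$, $\eta'(0)=-h^2$ and $\eta''\ge0$ almost everywhere, and for $\eta\in\Lambda$ let $$D(\eta)=\frac12\left(\int_0^1\Big(2\sqrt{\eta''(s)}-\eta''(s)(1-s)-\frac1{1-s}\Big)ds-\eta(0)+h^2+\xi(1)\right)\in[-\infty,\infty).$$ Let $\mu$ minimize $P$ over the Borel probability measures on $[0,1]$ and let $\eta$ maximize $D$ over $\Lambda$. Write $\{\eta=\xi\}=\{s\in[0,1):\eta(s)=\xi(s)\}$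 for the coincidence set, and let $\mathfrak d=\big(1/\sqrt{\xi''}\big)''$ on $(0,1)$. 1. If $\mathfrak d$ is not identically zero on $(0,1)$, then every element of $\{\eta=\xi\}\setminus\operatorname{supp}\mu$ is an isolated point of $\{\eta=\xi\}$. 2. If $\mathfrak d$ is identically zero on $(0,1)$, then there are $m\in[0,1]$ and $r_1\le r_2$ in $[0,1]$ such that $\mu=m\delta_{r_1}+(1-m)\delta_{r_2}$ and $\{\eta=\xi\}=[r_1,r_2]$. -/

import Mathlib

open Set MeasureTheory Topology
open scoped ENNReal

noncomputable section

namespace CrisantiSommers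

/-- The covariance function `ξ(t) = β² ∑_{p ≥ 2} β_p² t^p`. Only the values `b p`, `p ≥ 2`,
of the sequence `b = (β_p)` enter. -/
def xi (β : ℝ) (b : ℕ → ℝ) (t : ℝ) : ℝ :=
  β ^ 2 * ∑' k : ℕ, (b (k + 2)) ^ 2 * t ^ (k + 2)

/-- The set `Pr([0,1])`: Borel probability measures on the line that are carried by `[0,1]`. -/
def prUnit : Set (Measure ℝ) :=
  {μ | IsProbabilityMeasure μ ∧ μ (Icc (0 : ℝ) 1)ᶜ = 0}

/-- `φ_μ(t) = ∫_t^1 μ([0,s]) ds`. -/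
def phi (μ : Measure ℝ) (t : ℝ) : ℝ :=
  ∫ s in t..1, μ.real (Icc 0 s)

/-- The Crisanti-Sommers functional
`½ (∫₀¹ ξ'' φ_μ ds + ∫₀¹ (1/φ_μ - 1/(1-s)) ds + h² φ_μ(0))`, with values in `[0,∞]`.
For `μ ∈ Pr([0,1])` one has `0 ≤ φ_μ(s) ≤ 1 - s` and `ξ'' ≥ 0`, so all the terms are nonnegative;
the inverses are taken in `[0,∞]`, so that `1/φ_μ = ∞` where `φ_μ = 0`. -/
def primal (ξ : ℝ → ℝ) (h : ℝ) (μ : Measure ℝ) : ℝ≥0∞ :=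
  2⁻¹ * ((∫⁻ s in Ioo (0 : ℝ) 1, ENNReal.ofReal (iteratedDeriv 2 ξ s * phi μ s))
    + (∫⁻ s in Ioo (0 : ℝ) 1, ((ENNReal.ofReal (phi μ s))⁻¹ - (ENNReal.ofReal (1 - s))⁻¹))
    + ENNReal.ofReal (h ^ 2 * phi μ 0))

/-- The derivative of a function on `[0,1)` (one-sided at `0`). -/
def d1 (η : ℝ → ℝ) : ℝ → ℝ := derivWithin η (Ico 0 1)

/-- The second derivative of a function on `[0,1)`. When `η'` is locally Lipschitz it exists at
almost every point and represents the distributional second derivative. -/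
def d2 (η : ℝ → ℝ) : ℝ → ℝ := derivWithin (d1 η) (Ico 0 1)

/-- The space `X` of functions `η ∈ C¹([0,1))` with `η' ∈ Lip_loc([0,1))`. Only the restriction of
`η` to `[0,1)` matters, here and below. -/
def spaceX : Set (ℝ → ℝ) :=
  {η | ContDiffOn ℝ 1 η (Ico 0 1) ∧ LocallyLipschitzOn (Ico 0 1) (d1 η)}

/-- The admissible class `Λ_{ξ,h}`. -/
def admissible (ξ : ℝ → ℝ) (h : ℝ) : Set (ℝ → ℝ) :=
  {η | η ∈ spaceX ∧ (∀ s ∈ Ico (0 : ℝ) 1, ξ s ≤ η s) ∧ d1 η 0 = -h ^ 2 ∧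
    ∀ᵐ s ∂(volume.restrict (Ioo (0 : ℝ) 1)), 0 ≤ d2 η s}

/-- The dual functional
`½ (∫₀¹ (2 √η'' - η'' (1-s) - 1/(1-s)) ds - η(0) + h² + ξ(1))`, with values in `[-∞,∞)`.
The integrand is nonpositive almost everywhere, so its integral is minus the `[0,∞]`-valued
integral of its negative. -/
def dual (ξ : ℝ → ℝ) (h : ℝ) (η : ℝ → ℝ) : EReal :=
  ((1 / 2 : ℝ) : EReal) *
    (-((∫⁻ s in Ioo (0 : ℝ) 1, ENNReal.ofReal
        (-(2 * √(d2 η s) - d2 η s * (1 - s) - 1 / (1 - s))) : ℝ≥0∞) : EReal)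
      + ((-η 0 + h ^ 2 + ξ 1 : ℝ) : EReal))

/-- The coincidence set `{s ∈ [0,1) : η(s) = ξ(s)}`. -/
def coincidence (ξ η : ℝ → ℝ) : Set ℝ := {s | s ∈ Ico (0 : ℝ) 1 ∧ η s = ξ s}

/-- `𝔡 = (1/√ξ'')''`. -/
def dfrak (ξ : ℝ → ℝ) : ℝ → ℝ :=
  iteratedDeriv 2 (fun t => 1 / √(iteratedDeriv 2 ξ t))

end CrisantiSommers

end

/-!
The two variational problems are dual to each other, and the proof passes from the minimizer `μ` of
the primal functional to a dual certificate.

*The certificate.* Comparing `μ` with its truncations shows that `μ` is carried by some `[0,Q]` with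
`Q < 1` (`exists_measure_Ioi_eq_zero`); in particular `φ_μ(s) = 1 - s` near `1`, and the
singular integrals reduce to integrals over `[0,Q]`, where `φ_μ` is bounded below. Let `e` solve
`e'' = 1/φ_μ²`, `e'(0) = -h²`. The first variation of the primal functional at `μ` in the direction
of a point mass `δ_r` equals, after two integrations by parts (`integral_mul_phi_sub_phi`), half the
value of `e - ξ` at `r` minus half its `μ`-mean. So `e - ξ` is bounded below by its mean, hence equal
to it `μ`-almost everywhere, and
after subtraction of that constant `e` is admissible and touches `ξ` at `μ`-almost every point
(`exists_isCertificate`).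

*Uniqueness in the dual problem.* Completing the square gives, with the same integration by parts,
`2 D(e) - 2 D(η) = ∫ φ_μ (√η'' - 1/φ_μ)² + ∫ (η - ξ) dμ` for admissible `η` (in the proof the
integrals are cut off at a level below `1`), so a maximizer `η` coincides with `e` on `[0,1)`
(`IsCertificate.eqOn_of_isMaxOn`).

*The coincidence set.* On an interval that `μ` does not charge, `φ_μ` is affine. At contact points
`e - ξ` vanishes to first order, so between two of them Rolle's theorem yields a point where
`φ_μ² ξ'' = 1`. If contact points accumulate at a point off the support of `μ`, then
`ξ'' A² = 1` holds for some affine `A` on a sequence with a limit, hence identically by analyticity,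
and `𝔡 = 0`. If conversely `𝔡 = 0`, then `1/√ξ''` is affine; Rolle's theorem, applied
once more inside a gap of the coincidence set, gives two points where the affine functions `φ_μ` and
`1/√ξ''` agree, so that `e = ξ` on the gap, a contradiction. Hence the coincidence set is an interval
`[r₁,r₂]`; inside it `φ_μ = 1/√ξ''` is affine, so `μ` charges only the endpoints.
-/

namespace CrisantiSommers

/-! ### Power series and the covariance function -/

/-- Termwise differentiation costs an arbitrarily small part of the radius of convergence. -/
lemma summable_deriv_coeff {γ : ℕ → ℝ} {R r : ℝ} (hR : Summable fun n => |γ n| * R ^ n)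
    (hr : 0 < r) (hrR : r < R) : Summable fun n => |(n + 1) * γ (n + 1)| * r ^ n := by
  have hR0 : 0 < R := hr.trans hrR
  have hg : Summable fun n : ℕ => ((n : ℝ) + 1) * (r / R) ^ n := by
    have h1 : ‖r / R‖ < 1 := by
      rw [Real.norm_of_nonneg (by positivity)]
      exact (div_lt_one hR0).2 hrR
    have h2 := summable_pow_mul_geometric_of_norm_lt_one 1 h1
    have h3 := summable_geometric_of_norm_lt_one h1
    simpa [add_mul] using h2.add h3
  refine Summable.of_nonneg_of_le (fun n => by positivity) (fun n => ?_)
    (hg.mul_left ((∑' n, |γ n| * R ^ n) / R))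
  have hle : |γ (n + 1)| * R ^ (n + 1) ≤ ∑' n, |γ n| * R ^ n :=
    hR.le_tsum (n + 1) (fun j _ => by positivity)
  have h1 : |((n : ℝ) + 1) * γ (n + 1)| = ((n : ℝ) + 1) * |γ (n + 1)| := by
    rw [abs_mul, abs_of_nonneg (by positivity)]
  rw [h1]
  calc ((n : ℝ) + 1) * |γ (n + 1)| * r ^ n
      = (|γ (n + 1)| * R ^ (n + 1)) / R * (((n : ℝ) + 1) * (r / R) ^ n) := by
        rw [div_pow, pow_succ]; field_simp
    _ ≤ _ := by gcongr

lemma hasDerivAt_tsum_powers {γ : ℕ → ℝ} {R t : ℝ} (hR : Summable fun n => |γ n| * R ^ n)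
    (ht : |t| < R) :
    HasDerivAt (fun t => ∑' n, γ n * t ^ n) (∑' n : ℕ, ((n + 1) * γ (n + 1)) * t ^ n) t := by
  obtain ⟨r, htr, hrR⟩ := exists_between ht
  have hr0 : 0 < r := (abs_nonneg t).trans_lt htr
  have hs := summable_deriv_coeff hR hr0 hrR
  have hu : Summable fun n : ℕ => |n * γ n| * r ^ (n - 1) := by
    rw [← summable_nat_add_iff 1]
    simpa using hs
  have key := hasDerivAt_tsum_of_isPreconnected (𝕜 := ℝ) (F := ℝ)
    (g := fun n t => γ n * t ^ n) (g' := fun n t => γ n * (n * t ^ (n - 1)))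
    (t := Metric.ball 0 r) (y₀ := 0) (y := t) hu Metric.isOpen_ball
    (convex_ball 0 r).isPreconnected
    (fun n y _ => (hasDerivAt_pow n y).const_mul (γ n))
    (fun n y hy => by
      have hy' : |y| ≤ r := by simpa using (mem_ball_zero_iff.1 hy).le
      rw [Real.norm_eq_abs, abs_mul, abs_mul, abs_pow, abs_mul, mul_left_comm, mul_assoc]
      gcongr)
    (Metric.mem_ball_self hr0)
    (summable_of_ne_finset_zero (s := {0}) (fun n hn => by
      have : n ≠ 0 := by simpa using hn
      simp [this]))
    (by simpa using htr)
  convert! key using 1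
  rw [Summable.tsum_eq_zero_add (f := fun n => γ n * (n * t ^ (n - 1)))]
  · simp only [CharP.cast_eq_zero, zero_mul, mul_zero, zero_add]
    refine tsum_congr fun n => ?_
    push_cast
    ring
  · refine Summable.of_norm_bounded hu fun n => ?_
    rw [Real.norm_eq_abs, abs_mul, abs_mul, abs_pow, abs_mul, mul_left_comm, mul_assoc]
    gcongr

lemma analyticOnNhd_tsum_powers {γ : ℕ → ℝ} {R : ℝ} (hR0 : 0 < R)
    (hR : Summable fun n => |γ n| * R ^ n) :
    AnalyticOnNhd ℝ (fun t => ∑' n, γ n * t ^ n) (Metric.ball 0 R) := by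
  set p := FormalMultilinearSeries.ofScalars ℝ γ with hp
  lift R to NNReal using hR0.le
  have hrad : (R : ℝ≥0∞) ≤ p.radius := by
    refine p.le_radius_of_summable_norm ?_
    simpa [hp, FormalMultilinearSeries.ofScalars_norm] using hR
  have h1 := p.hasFPowerSeriesOnBall (lt_of_lt_of_le (by simpa using hR0) hrad)
  have h2 : p.sum = fun t => ∑' n, γ n * t ^ n := by
    ext t
    rw [hp]
    exact (FormalMultilinearSeries.ofScalars_sum_eq γ t).trans (by simp)
  rw [h2] at h1
  refine h1.analyticOnNhd.mono fun t ht => ?_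
  refine Metric.eball_subset_eball hrad ?_
  rw [Metric.eball_coe]
  exact ht

/-- The properties of `ξ` on which the duality argument rests; `ξ` is analytic on a disc of radius
`R > 1`, so that `ξ''` is continuous on all of `[0,1]`. -/
structure IsCovariance (ξ : ℝ → ℝ) (R : ℝ) : Prop where
  one_lt : 1 < R
  analytic : AnalyticOnNhd ℝ ξ (Metric.ball 0 R)
  deriv_zero : deriv ξ 0 = 0
  pos : ∀ t ∈ Ioo (0 : ℝ) 1, 0 < iteratedDeriv 2 ξ t

lemma isCovariance_xi {β : ℝ} {b : ℕ → ℝ} (hβ : β ≠ 0) (hb : ∃ p, 2 ≤ p ∧ b p ≠ 0) {ε : ℝ}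
    (hε : 0 < ε) (hs : Summable fun k : ℕ => (b (k + 2)) ^ 2 * (1 + ε) ^ (k + 2)) :
    IsCovariance (xi β b) (1 + ε / 3) := by
  set γ : ℕ → ℝ := fun n => if n < 2 then 0 else β ^ 2 * b n ^ 2 with hγ
  have hγ0 : ∀ n, 0 ≤ γ n := fun n => by
    simp only [hγ]; split_ifs <;> positivity
  have hR : Summable fun n => |γ n| * (1 + ε) ^ n := by
    rw [← summable_nat_add_iff 2]
    refine (hs.mul_left (β ^ 2)).congr fun k => ?_
    rw [abs_of_nonneg (hγ0 _)]
    simp [hγ, mul_assoc]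
  have hxi : ∀ t, |t| < 1 + ε → xi β b t = ∑' n, γ n * t ^ n := fun t ht => by
    have hsum : Summable fun n => γ n * t ^ n := by
      refine Summable.of_norm_bounded hR fun n => ?_
      rw [norm_mul, norm_pow, Real.norm_eq_abs, Real.norm_eq_abs]
      gcongr
    rw [← hsum.sum_add_tsum_nat_add 2, xi, ← tsum_mul_left]
    simp [hγ, mul_assoc, Finset.sum_range_succ]
  have hs1 := summable_deriv_coeff hR (r := 1 + 2 * ε / 3) (by positivity) (by linarith)
  have hs2 := summable_deriv_coeff hs1 (r := 1 + ε / 3) (by positivity) (by linarith)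
  have hev : ∀ t, |t| < 1 + ε → xi β b =ᶠ[𝓝 t] fun t => ∑' n, γ n * t ^ n := fun t ht => by
    filter_upwards [(isOpen_lt continuous_abs continuous_const).mem_nhds ht] with s hs using hxi s hs
  have hd1 : ∀ t, |t| < 1 + ε →
      deriv (xi β b) t = ∑' n : ℕ, ((n + 1) * γ (n + 1)) * t ^ n := fun t ht =>
    (hev t ht).deriv_eq.trans (hasDerivAt_tsum_powers hR ht).deriv
  have hd2 : ∀ t, |t| < 1 + ε / 3 → iteratedDeriv 2 (xi β b) t
      = ∑' n : ℕ, ((n + 1) * (((n + 1 : ℕ) + 1) * γ (n + 1 + 1))) * t ^ n := fun t ht => by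
    rw [iteratedDeriv_succ, iteratedDeriv_one]
    have h1 : |t| < 1 + ε := by linarith
    have hev1 : deriv (xi β b) =ᶠ[𝓝 t] fun t => ∑' n : ℕ, ((n + 1) * γ (n + 1)) * t ^ n := by
      filter_upwards [(isOpen_lt continuous_abs continuous_const).mem_nhds h1] with s hs
        using hd1 s hs
    rw [hev1.deriv_eq]
    exact (hasDerivAt_tsum_powers hs1 (by linarith)).deriv
  refine ⟨by linarith, ?_, ?_, fun t ht => ?_⟩
  · have h1 := (analyticOnNhd_tsum_powers (by positivity) hR).mono
      (Metric.ball_subset_ball (show 1 + ε / 3 ≤ 1 + ε by linarith) (x := (0 : ℝ)))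
    refine h1.congr Metric.isOpen_ball fun t ht => (hxi t ?_).symm
    have : |t| < 1 + ε / 3 := by simpa using ht
    linarith
  · rw [hd1 0 (by simpa using by positivity), tsum_eq_single 0]
    · simp [hγ]
    · intro n hn; simp [hn]
  · have htR : |t| < 1 + ε / 3 := by rw [abs_of_pos ht.1]; linarith [ht.2]
    rw [hd2 t htR]
    obtain ⟨p, hp2, hbp⟩ := hb
    have hsum : Summable fun n : ℕ => ((n + 1) * (((n + 1 : ℕ) + 1) * γ (n + 1 + 1))) * t ^ n := by
      refine Summable.of_norm_bounded hs2 fun n => ?_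
      rw [norm_mul, norm_pow, Real.norm_eq_abs, Real.norm_eq_abs]
      gcongr
    have hpos : ∀ n : ℕ, 0 ≤ ((n + 1) * (((n + 1 : ℕ) + 1) * γ (n + 1 + 1))) * t ^ n := fun n => by
      have := hγ0 (n + 1 + 1)
      have := ht.1
      positivity
    refine hsum.tsum_pos hpos (p - 2) ?_
    have h1 : 0 < γ (p - 2 + 1 + 1) := by
      have : p - 2 + 1 + 1 = p := by omega
      rw [this]
      simp only [hγ, if_neg (not_lt.2 hp2)]
      positivity
    have := ht.1
    positivity

namespace IsCovariance

variable {ξ : ℝ → ℝ} {R : ℝ}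

lemma mem_ball (hξ : IsCovariance ξ R) {t : ℝ} (ht : t ∈ Icc (0 : ℝ) 1) : t ∈ Metric.ball 0 R := by
  have := hξ.one_lt
  rw [mem_ball_zero_iff, Real.norm_eq_abs, abs_of_nonneg ht.1]
  linarith [ht.2]

lemma analytic_deriv (hξ : IsCovariance ξ R) : AnalyticOnNhd ℝ (deriv ξ) (Metric.ball 0 R) :=
  hξ.analytic.deriv

lemma analytic_deriv2 (hξ : IsCovariance ξ R) :
    AnalyticOnNhd ℝ (iteratedDeriv 2 ξ) (Metric.ball 0 R) := by
  have : iteratedDeriv 2 ξ = deriv (deriv ξ) := by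
    rw [iteratedDeriv_succ, iteratedDeriv_one]
  rw [this]
  exact hξ.analytic.deriv.deriv

lemma hasDerivAt (hξ : IsCovariance ξ R) {t : ℝ} (ht : t ∈ Icc (0 : ℝ) 1) :
    HasDerivAt ξ (deriv ξ t) t :=
  (hξ.analytic t (hξ.mem_ball ht)).differentiableAt.hasDerivAt

lemma hasDerivAt_deriv (hξ : IsCovariance ξ R) {t : ℝ} (ht : t ∈ Icc (0 : ℝ) 1) :
    HasDerivAt (deriv ξ) (iteratedDeriv 2 ξ t) t := by
  rw [iteratedDeriv_succ, iteratedDeriv_one]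
  exact (hξ.analytic_deriv t (hξ.mem_ball ht)).differentiableAt.hasDerivAt

lemma continuousOn_deriv2 (hξ : IsCovariance ξ R) :
    ContinuousOn (iteratedDeriv 2 ξ) (Icc 0 1) :=
  fun _ ht => (hξ.analytic_deriv2 _ (hξ.mem_ball ht)).continuousAt.continuousWithinAt

lemma nonneg (hξ : IsCovariance ξ R) {t : ℝ} (ht : t ∈ Icc (0 : ℝ) 1) :
    0 ≤ iteratedDeriv 2 ξ t := by
  have hcl : t ∈ closure (Ioo (0 : ℝ) 1) := by
    rw [closure_Ioo zero_ne_one]; exact ht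
  refine closure_minimal (s := Ioo (0 : ℝ) 1) (t := {t | t ∈ Icc (0 : ℝ) 1 ∧ 0 ≤ iteratedDeriv 2 ξ t})
    (fun s hs => ⟨Ioo_subset_Icc_self hs, (hξ.pos s hs).le⟩) ?_ hcl |>.2
  exact hξ.continuousOn_deriv2.preimage_isClosed_of_isClosed isClosed_Icc isClosed_Ici

end IsCovariance

/-! ### The functions `φ_μ` -/

lemma monotone_cdf (ν : Measure ℝ) [IsFiniteMeasure ν] :
    Monotone fun s => ν.real (Icc 0 s) :=
  fun _ _ hst => measureReal_mono (Icc_subset_Icc_right hst)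

lemma intervalIntegrable_cdf (ν : Measure ℝ) [IsFiniteMeasure ν] (s t : ℝ) :
    IntervalIntegrable (fun s => ν.real (Icc 0 s)) volume s t :=
  (monotone_cdf ν).intervalIntegrable

lemma phi_sub_phi (ν : Measure ℝ) [IsFiniteMeasure ν] (s t : ℝ) :
    phi ν s - phi ν t = ∫ u in s..t, ν.real (Icc 0 u) := by
  rw [phi, phi, ← intervalIntegral.integral_add_adjacent_intervals
    (intervalIntegrable_cdf ν s t) (intervalIntegrable_cdf ν t 1), add_sub_cancel_right]

@[simp] lemma phi_one (ν : Measure ℝ) : phi ν 1 = 0 := by simp [phi]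

lemma phi_sub_phi_nonneg (ν : Measure ℝ) [IsFiniteMeasure ν] {s t : ℝ} (hst : s ≤ t) :
    0 ≤ phi ν s - phi ν t := by
  rw [phi_sub_phi]
  exact intervalIntegral.integral_nonneg hst fun _ _ => measureReal_nonneg

lemma phi_sub_phi_le (ν : Measure ℝ) [IsProbabilityMeasure ν] {s t : ℝ} (hst : s ≤ t) :
    phi ν s - phi ν t ≤ t - s := by
  rw [phi_sub_phi]
  have h := intervalIntegral.integral_mono_on hst (intervalIntegrable_cdf ν s t)
    (intervalIntegrable_const (c := (1 : ℝ))) fun _ _ => measureReal_le_one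
  simpa using h

lemma phi_nonneg (ν : Measure ℝ) [IsFiniteMeasure ν] {t : ℝ} (ht : t ≤ 1) : 0 ≤ phi ν t := by
  simpa using phi_sub_phi_nonneg ν ht

lemma phi_le (ν : Measure ℝ) [IsProbabilityMeasure ν] {t : ℝ} (ht : t ≤ 1) :
    phi ν t ≤ 1 - t := by
  simpa using phi_sub_phi_le ν ht

lemma lipschitzWith_phi (ν : Measure ℝ) [IsProbabilityMeasure ν] : LipschitzWith 1 (phi ν) := by
  refine LipschitzWith.of_dist_le_mul fun s t => ?_
  rw [NNReal.coe_one, one_mul, Real.dist_eq, Real.dist_eq]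
  rcases le_total s t with hst | hst
  · rw [abs_of_nonneg (phi_sub_phi_nonneg ν hst), abs_sub_comm, abs_of_nonneg (sub_nonneg.2 hst)]
    exact phi_sub_phi_le ν hst
  · rw [abs_sub_comm, abs_of_nonneg (phi_sub_phi_nonneg ν hst), abs_of_nonneg (sub_nonneg.2 hst)]
    exact phi_sub_phi_le ν hst

lemma continuous_phi (ν : Measure ℝ) [IsProbabilityMeasure ν] : Continuous (phi ν) :=
  (lipschitzWith_phi ν).continuous

lemma phi_mixture (μ ν : Measure ℝ) [IsFiniteMeasure μ] [IsFiniteMeasure ν] {ε : ℝ} (h0 : 0 ≤ ε)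
    (h1 : ε ≤ 1) (t : ℝ) :
    phi (ENNReal.ofReal (1 - ε) • μ + ENNReal.ofReal ε • ν) t
      = (1 - ε) * phi μ t + ε * phi ν t := by
  have := Measure.smul_finite μ (ENNReal.ofReal_ne_top (r := 1 - ε))
  have := Measure.smul_finite ν (ENNReal.ofReal_ne_top (r := ε))
  have h : ∀ s, (ENNReal.ofReal (1 - ε) • μ + ENNReal.ofReal ε • ν).real (Icc 0 s)
      = (1 - ε) * μ.real (Icc 0 s) + ε * ν.real (Icc 0 s) := fun s => by
    rw [measureReal_add_apply, measureReal_ennreal_smul_apply, measureReal_ennreal_smul_apply,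
      ENNReal.toReal_ofReal h0, ENNReal.toReal_ofReal (sub_nonneg.2 h1)]
  simp only [phi, h]
  rw [intervalIntegral.integral_add ((intervalIntegrable_cdf μ t 1).const_mul _)
    ((intervalIntegrable_cdf ν t 1).const_mul _), intervalIntegral.integral_const_mul,
    intervalIntegral.integral_const_mul]

lemma mixture_mem_prUnit {μ ν : Measure ℝ} (hμ : μ ∈ prUnit) (hν : ν ∈ prUnit) {ε : ℝ}
    (h0 : 0 ≤ ε) (h1 : ε ≤ 1) :
    ENNReal.ofReal (1 - ε) • μ + ENNReal.ofReal ε • ν ∈ prUnit := by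
  have := hμ.1
  have := hν.1
  refine ⟨⟨?_⟩, by simp [hμ.2, hν.2]⟩
  simp [← ENNReal.ofReal_add (sub_nonneg.2 h1) h0]

lemma dirac_mem_prUnit {r : ℝ} (hr : r ∈ Icc (0 : ℝ) 1) : Measure.dirac r ∈ prUnit :=
  ⟨inferInstance, by simp [Measure.dirac_apply' _ measurableSet_Icc.compl, hr.1, hr.2]⟩

lemma ae_mem_Icc {ν : Measure ℝ} (hν : ν ∈ prUnit) {Q : ℝ} (hQ : ν (Ioi Q) = 0) :
    ∀ᵐ r ∂ν, r ∈ Icc 0 Q := by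
  have h1 : ∀ᵐ r ∂ν, r ∈ Icc (0 : ℝ) 1 := hν.2
  have h2 : ∀ᵐ r ∂ν, r ∉ Ioi Q := measure_eq_zero_iff_ae_notMem.1 hQ
  filter_upwards [h1, h2] with r hr1 hr2 using ⟨hr1.1, not_lt.1 hr2⟩

lemma cdf_eq_one {ν : Measure ℝ} (hν : ν ∈ prUnit) {Q s : ℝ} (hQ : ν (Ioi Q) = 0) (hs : Q ≤ s) :
    ν.real (Icc 0 s) = 1 := by
  have := hν.1
  have h : ν (Icc 0 s) = 1 := by
    rw [← mem_ae_iff_prob_eq_one measurableSet_Icc]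
    filter_upwards [ae_mem_Icc hν hQ] with r hr using ⟨hr.1, hr.2.trans hs⟩
  simp [measureReal_def, h]

lemma phi_eq_one_sub {ν : Measure ℝ} (hν : ν ∈ prUnit) {Q s : ℝ} (hQ : ν (Ioi Q) = 0)
    (hs : Q ≤ s) (hs1 : s ≤ 1) : phi ν s = 1 - s := by
  have := hν.1
  rw [phi, intervalIntegral.integral_congr (g := fun _ => (1 : ℝ))]
  · simp
  · intro u hu
    rw [uIcc_of_le hs1] at hu
    exact cdf_eq_one hν hQ (hs.trans hu.1)

/-- If `φ_ν` reaches its largest possible value `1 - q` at `q`, then `ν` is carried by `[0,q]`. -/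
lemma measure_Ioi_eq_zero {ν : Measure ℝ} (hν : ν ∈ prUnit) {q Q : ℝ} (hq : 1 - q ≤ phi ν q)
    (hqQ : q < Q) (hQ1 : Q ≤ 1) : ν (Ioi Q) = 0 := by
  have := hν.1
  by_contra hne
  have hlt : ν.real (Icc 0 Q) < 1 := by
    refine lt_of_le_of_ne measureReal_le_one fun h => hne ?_
    have h1 : ν (Icc 0 Q) = 1 := by
      rw [measureReal_def] at h
      rwa [ENNReal.toReal_eq_one_iff] at h
    have h2 : ∀ᵐ r ∂ν, r ∈ Icc 0 Q :=
      (mem_ae_iff_prob_eq_one measurableSet_Icc).2 h1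
    rw [measure_eq_zero_iff_ae_notMem]
    filter_upwards [h2] with r hr using not_lt.2 hr.2
  have h1 : phi ν q - phi ν Q ≤ (Q - q) * ν.real (Icc 0 Q) := by
    rw [phi_sub_phi]
    have h := intervalIntegral.integral_mono_on hqQ.le (intervalIntegrable_cdf ν q Q)
      (intervalIntegrable_const (c := ν.real (Icc 0 Q))) fun u hu => monotone_cdf ν hu.2
    simpa using h
  have h2 := phi_le ν hQ1
  nlinarith

lemma phi_pos_of_measure_Ioi {ν : Measure ℝ} (hν : ν ∈ prUnit) {Q s : ℝ} (hQ : ν (Ioi Q) = 0)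
    (hQ1 : Q < 1) (hs : s < 1) : 0 < phi ν s := by
  have := hν.1
  have h1 := phi_sub_phi_nonneg ν (le_max_left s Q)
  rw [phi_eq_one_sub hν hQ (le_max_right s Q) (max_le hs.le hQ1.le)] at h1
  have : max s Q < 1 := max_lt hs hQ1
  linarith

/-! ### Integration by parts against `φ_μ` -/

lemma integrable_of_continuousOn {ν : Measure ℝ} (hν : ν ∈ prUnit) {Q : ℝ} (hQ : ν (Ioi Q) = 0)
    {k : ℝ → ℝ} (hk : ContinuousOn k (Icc 0 Q)) : Integrable k ν := by
  have := hν.1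
  have h : ν.restrict (Icc 0 Q) = ν := Measure.restrict_eq_self_of_ae_mem (ae_mem_Icc hν hQ)
  rw [← h]
  exact hk.integrableOn_compact isCompact_Icc

/-- Fubini's theorem for the distribution function of `ν`. -/
lemma integral_mul_cdf {ν : Measure ℝ} (hν : ν ∈ prUnit) {Q : ℝ} (hQ0 : 0 ≤ Q)
    (hQ : ν (Ioi Q) = 0) {k k1 : ℝ → ℝ} (hk1 : IntervalIntegrable k1 volume 0 Q)
    (hk : ∀ s ∈ Icc 0 Q, k s = k 0 + ∫ u in (0 : ℝ)..s, k1 u) :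
    ∫ s in (0 : ℝ)..Q, k1 s * ν.real (Icc 0 s) = ∫ r, (k Q - k r) ∂ν := by
  have := hν.1
  have hk1' : Integrable k1 (volume.restrict (Ioc 0 Q)) := hk1.1
  set T : Set (ℝ × ℝ) := {p | p.2 ∈ Icc 0 p.1} with hT
  have hTm : MeasurableSet T :=
    (measurableSet_le measurable_const measurable_snd).inter
      (measurableSet_le measurable_snd measurable_fst)
  have hint : Integrable (Function.uncurry fun s r => T.indicator (fun p => k1 p.1) (s, r))
      ((volume.restrict (Ioc 0 Q)).prod ν) := (hk1'.comp_fst ν).indicator hTm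
  have hswap := integral_integral_swap hint
  rw [intervalIntegral.integral_of_le hQ0]
  have hL : ∀ s, ∫ r, T.indicator (fun p => k1 p.1) (s, r) ∂ν = k1 s * ν.real (Icc 0 s) := fun s => by
    have : (fun r => T.indicator (fun p => k1 p.1) (s, r)) = (Icc 0 s).indicator fun _ => k1 s := by
      ext r
      simp [hT, indicator]
    rw [this, integral_indicator measurableSet_Icc, setIntegral_const, smul_eq_mul, mul_comm]
  simp only [hL] at hswap
  rw [hswap]
  refine integral_congr_ae ?_
  filter_upwards [ae_mem_Icc hν hQ] with r hr
  have h1 : ∫ s in Ioc 0 Q, T.indicator (fun p => k1 p.1) (s, r) = ∫ s in Ioc 0 Q ∩ Ici r, k1 s := by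
    rw [← setIntegral_indicator measurableSet_Ici]
    congr 1
    ext s
    simp [hT, indicator, hr.1]
  have h2 : ∫ s in Ioc 0 Q ∩ Ici r, k1 s = ∫ s in Ioc r Q, k1 s := by
    refine setIntegral_congr_set ?_
    have hIci : (Ioc 0 Q ∩ Ici r : Set ℝ) =ᵐ[volume] (Ioc 0 Q ∩ Ioi r : Set ℝ) :=
      ae_eq_set_inter (ae_eq_refl _) Ioi_ae_eq_Ici.symm
    refine hIci.trans (Filter.EventuallyEq.of_eq ?_)
    rw [Ioc_inter_Ioi, max_eq_right hr.1]
  have hQm : Q ∈ Icc 0 Q := ⟨hQ0, le_rfl⟩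
  rw [h1, h2, ← intervalIntegral.integral_of_le hr.2, hk Q hQm, hk r hr,
    ← intervalIntegral.integral_add_adjacent_intervals (b := r) (a := 0) (c := Q)
      (hk1.mono_set (by rw [uIcc_of_le hr.1, uIcc_of_le hQ0]; exact Icc_subset_Icc_right hr.2))
      (hk1.mono_set (by rw [uIcc_of_le hr.2, uIcc_of_le hQ0]; exact Icc_subset_Icc_left hr.1))]
  ring

lemma integral_mul_phi {ν : Measure ℝ} (hν : ν ∈ prUnit) {Q : ℝ} (hQ0 : 0 ≤ Q)
    (hQ : ν (Ioi Q) = 0) {k k1 w : ℝ → ℝ} (hw : IntervalIntegrable w volume 0 Q)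
    (hk1 : ∀ s ∈ Icc 0 Q, k1 s = k1 0 + ∫ u in (0 : ℝ)..s, w u)
    (hk : ∀ s ∈ Icc 0 Q, k s = k 0 + ∫ u in (0 : ℝ)..s, k1 u) :
    ∫ s in (0 : ℝ)..Q, w s * phi ν s
      = k1 Q * phi ν Q - k1 0 * phi ν 0 + ∫ r, (k Q - k r) ∂ν := by
  have := hν.1
  set K : ℝ → ℝ := fun s => k1 0 + ∫ u in (0 : ℝ)..s, w u with hK
  have hu : uIcc 0 Q = Icc 0 Q := uIcc_of_le hQ0
  have hK0 : K 0 = k1 0 := by simp [hK]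
  have hKac : AbsolutelyContinuousOnInterval K 0 Q := by
    have h1 := hw.absolutelyContinuousOnInterval_intervalIntegral (c := 0) (by simp)
    have h2 : AbsolutelyContinuousOnInterval (fun _ : ℝ => k1 0) 0 Q :=
      ((LipschitzWith.const (k1 0)).lipschitzOnWith (s := uIcc 0 Q)).absolutelyContinuousOnInterval
    exact h2.add h1
  have hφac : AbsolutelyContinuousOnInterval (phi ν) 0 Q :=
    ((lipschitzWith_phi ν).lipschitzOnWith (s := uIcc 0 Q)).absolutelyContinuousOnInterval
  have hparts := hKac.integral_mul_deriv_eq_deriv_mul hφac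
  have hd1 : ∫ s in (0 : ℝ)..Q, K s * deriv (phi ν) s
      = -∫ s in (0 : ℝ)..Q, K s * ν.real (Icc 0 s) := by
    rw [← intervalIntegral.integral_neg]
    refine intervalIntegral.integral_congr_ae ?_
    filter_upwards [(intervalIntegrable_cdf ν 0 Q).ae_hasDerivAt_integral] with s hs hsm
    have h1 := hs (uIoc_subset_uIcc hsm) 0 (by simp)
    have h2 : phi ν = fun t => phi ν 0 - ∫ u in (0 : ℝ)..t, ν.real (Icc 0 u) := by
      ext t; rw [← phi_sub_phi]; ring
    have h3 : HasDerivAt (phi ν) (-ν.real (Icc 0 s)) s := by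
      rw [h2]; simpa using h1.const_sub (phi ν 0)
    rw [h3.deriv]; ring
  have hd2 : ∫ s in (0 : ℝ)..Q, deriv K s * phi ν s = ∫ s in (0 : ℝ)..Q, w s * phi ν s := by
    refine intervalIntegral.integral_congr_ae ?_
    filter_upwards [hw.ae_hasDerivAt_integral] with s hs hsm
    have h1 := hs (uIoc_subset_uIcc hsm) 0 (by simp)
    rw [(h1.const_add (k1 0)).deriv]
  have hKint : IntervalIntegrable K volume 0 Q := hKac.continuousOn.intervalIntegrable
  have hfub := integral_mul_cdf hν hQ0 hQ (k := k) hKint fun s hs => by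
    rw [hk s hs]
    congr 1
    refine intervalIntegral.integral_congr fun u hus => ?_
    rw [uIcc_of_le hs.1] at hus
    exact hk1 u ⟨hus.1, hus.2.trans hs.2⟩
  have hKQ : K Q = k1 Q := (hk1 Q ⟨hQ0, le_rfl⟩).symm
  rw [hd1, hd2, hfub, hK0, hKQ] at hparts
  linarith

/-- Integration by parts twice: testing a second derivative against a difference of two `φ`'s
amounts to testing the function itself against the difference of the two measures. -/
lemma integral_mul_phi_sub_phi {ν ν' : Measure ℝ} (hν : ν ∈ prUnit) (hν' : ν' ∈ prUnit) {Q : ℝ}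
    (hQ0 : 0 ≤ Q) (hQ1 : Q ≤ 1) (hQ : ν (Ioi Q) = 0) (hQ' : ν' (Ioi Q) = 0) {k k1 w : ℝ → ℝ}
    (hw : IntervalIntegrable w volume 0 Q)
    (hk1 : ∀ s ∈ Icc 0 Q, k1 s = k1 0 + ∫ u in (0 : ℝ)..s, w u)
    (hk : ∀ s ∈ Icc 0 Q, k s = k 0 + ∫ u in (0 : ℝ)..s, k1 u) :
    ∫ s in (0 : ℝ)..Q, w s * (phi ν s - phi ν' s)
      = -k1 0 * (phi ν 0 - phi ν' 0) + ∫ r, k r ∂ν' - ∫ r, k r ∂ν := by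
  have := hν.1
  have := hν'.1
  have hu : uIcc 0 Q = Icc 0 Q := uIcc_of_le hQ0
  have hk1c : ContinuousOn k1 (Icc 0 Q) := by
    have h := intervalIntegral.continuousOn_primitive_interval' (a := 0) hw (by simp)
    rw [hu] at h
    exact (continuousOn_const.add h).congr hk1
  have hkc : ContinuousOn k (Icc 0 Q) := by
    have h := intervalIntegral.continuousOn_primitive_interval' (a := 0)
      (hk1c.intervalIntegrable_of_Icc (μ := volume) hQ0) (by simp)
    rw [hu] at h
    exact (continuousOn_const.add h).congr hk
  have h1 := integral_mul_phi hν hQ0 hQ hw hk1 hk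
  have h2 := integral_mul_phi hν' hQ0 hQ' hw hk1 hk
  rw [integral_sub (integrable_const _) (integrable_of_continuousOn hν hQ hkc),
    phi_eq_one_sub hν hQ le_rfl hQ1] at h1
  rw [integral_sub (integrable_const _) (integrable_of_continuousOn hν' hQ' hkc),
    phi_eq_one_sub hν' hQ' le_rfl hQ1] at h2
  simp only [integral_const, probReal_univ, one_smul] at h1 h2
  have h3 : ∫ s in (0 : ℝ)..Q, w s * (phi ν s - phi ν' s)
      = (∫ s in (0 : ℝ)..Q, w s * phi ν s) - ∫ s in (0 : ℝ)..Q, w s * phi ν' s := by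
    rw [← intervalIntegral.integral_sub (hw.mul_continuousOn (continuous_phi ν).continuousOn)
      (hw.mul_continuousOn (continuous_phi ν').continuousOn)]
    simp only [mul_sub]
  rw [h3, h1, h2]
  ring

/-! ### First-order condition for minimizers of the primal functional -/

/-- Twice the Crisanti-Sommers functional of a function `φ`, as a real number, the singular
integral being cut off at `q`. -/
noncomputable def primalReal (ξ : ℝ → ℝ) (h q : ℝ) (φ : ℝ → ℝ) : ℝ :=
  (∫ s in (0 : ℝ)..1, iteratedDeriv 2 ξ s * φ s) + (∫ s in (0 : ℝ)..q, (1 / φ s - 1 / (1 - s)))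
    + h ^ 2 * φ 0

lemma two_mul_primal (ξ : ℝ → ℝ) (h : ℝ) (ν : Measure ℝ) :
    2 * primal ξ h ν = (∫⁻ s in Ioo (0 : ℝ) 1, ENNReal.ofReal (iteratedDeriv 2 ξ s * phi ν s))
    + (∫⁻ s in Ioo (0 : ℝ) 1, ((ENNReal.ofReal (phi ν s))⁻¹ - (ENNReal.ofReal (1 - s))⁻¹))
    + ENNReal.ofReal (h ^ 2 * phi ν 0) := by
  rw [primal, ← mul_assoc, ENNReal.mul_inv_cancel (by simp) (by simp), one_mul]

section

variable {ξ : ℝ → ℝ} {R h : ℝ}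

lemma intervalIntegrable_deriv2_mul (hξ : IsCovariance ξ R) {φ : ℝ → ℝ} (hφ : Continuous φ)
    {a b : ℝ} (ha : a ∈ Icc (0 : ℝ) 1) (hb : b ∈ Icc (0 : ℝ) 1) :
    IntervalIntegrable (fun s => iteratedDeriv 2 ξ s * φ s) volume a b :=
  ((hξ.continuousOn_deriv2.mul hφ.continuousOn).mono
    (uIcc_subset_Icc ha hb)).intervalIntegrable

lemma lintegral_deriv2_mul_phi (hξ : IsCovariance ξ R) {ν : Measure ℝ} (hν : ν ∈ prUnit) :
    ∫⁻ s in Ioo (0 : ℝ) 1, ENNReal.ofReal (iteratedDeriv 2 ξ s * phi ν s)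
      = ENNReal.ofReal (∫ s in (0 : ℝ)..1, iteratedDeriv 2 ξ s * phi ν s) := by
  have := hν.1
  have hint := intervalIntegrable_deriv2_mul hξ (continuous_phi ν)
    (left_mem_Icc.2 zero_le_one) (right_mem_Icc.2 zero_le_one)
  rw [intervalIntegral.integral_of_le zero_le_one, ofReal_integral_eq_lintegral_ofReal hint.1,
    restrict_Ioo_eq_restrict_Ioc]
  filter_upwards [ae_restrict_mem measurableSet_Ioc] with s hs
  exact mul_nonneg (hξ.nonneg ⟨hs.1.le, hs.2⟩) (phi_nonneg ν hs.2)

lemma intervalIntegrable_inv_sub {φ : ℝ → ℝ} (hφ : Continuous φ) {q : ℝ} (hq0 : 0 ≤ q)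
    (hq1 : q < 1) (hpos : ∀ s ∈ Icc 0 q, 0 < φ s) :
    IntervalIntegrable (fun s => 1 / φ s - 1 / (1 - s)) volume 0 q := by
  refine ContinuousOn.intervalIntegrable_of_Icc hq0 ?_
  refine (continuousOn_const.div hφ.continuousOn fun s hs => (hpos s hs).ne').sub
    (continuousOn_const.div (by fun_prop) fun s hs => ?_)
  have := hs.2
  exact (sub_pos.2 (this.trans_lt hq1)).ne'

lemma one_div_sub_nonneg {ν : Measure ℝ} (hν : ν ∈ prUnit) {s : ℝ} (hs : s < 1)
    (hpos : 0 < phi ν s) : 0 ≤ 1 / phi ν s - 1 / (1 - s) := by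
  have := hν.1
  exact sub_nonneg.2 (one_div_le_one_div_of_le hpos (phi_le ν hs.le))

lemma phi_pos_of_le {ν : Measure ℝ} (hν : ν ∈ prUnit) {q s : ℝ} (hpos : 0 < phi ν q)
    (hs : s ≤ q) : 0 < phi ν s := by
  have := hν.1
  linarith [phi_sub_phi_nonneg ν hs]

lemma lintegral_Ioc_inv_sub {ν : Measure ℝ} (hν : ν ∈ prUnit) {q : ℝ} (hq0 : 0 ≤ q) (hq1 : q < 1)
    (hpos : 0 < phi ν q) :
    ∫⁻ s in Ioc (0 : ℝ) q, ((ENNReal.ofReal (phi ν s))⁻¹ - (ENNReal.ofReal (1 - s))⁻¹)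
      = ENNReal.ofReal (∫ s in (0 : ℝ)..q, (1 / phi ν s - 1 / (1 - s))) := by
  have := hν.1
  have hint := intervalIntegrable_inv_sub (continuous_phi ν) hq0 hq1
    fun s hs => phi_pos_of_le hν hpos hs.2
  rw [intervalIntegral.integral_of_le hq0, ofReal_integral_eq_lintegral_ofReal hint.1]
  · refine setLIntegral_congr_fun measurableSet_Ioc fun s hs => ?_
    have hs1 : s < 1 := hs.2.trans_lt hq1
    rw [← ENNReal.ofReal_inv_of_pos (phi_pos_of_le hν hpos hs.2),
      ← ENNReal.ofReal_inv_of_pos (sub_pos.2 hs1),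
      ← ENNReal.ofReal_sub _ (inv_nonneg.2 (sub_pos.2 hs1).le), one_div, one_div]
  · filter_upwards [ae_restrict_mem measurableSet_Ioc] with s hs
    exact one_div_sub_nonneg hν (hs.2.trans_lt hq1) (phi_pos_of_le hν hpos hs.2)

lemma ofReal_primalReal (hξ : IsCovariance ξ R) {ν : Measure ℝ} (hν : ν ∈ prUnit) {q : ℝ}
    (hq0 : 0 ≤ q) (hq1 : q < 1) (hpos : 0 < phi ν q) :
    ENNReal.ofReal (primalReal ξ h q (phi ν))
      = (∫⁻ s in Ioo (0 : ℝ) 1, ENNReal.ofReal (iteratedDeriv 2 ξ s * phi ν s))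
    + (∫⁻ s in Ioc (0 : ℝ) q, ((ENNReal.ofReal (phi ν s))⁻¹ - (ENNReal.ofReal (1 - s))⁻¹))
    + ENNReal.ofReal (h ^ 2 * phi ν 0) := by
  have := hν.1
  have h1 : 0 ≤ ∫ s in (0 : ℝ)..1, iteratedDeriv 2 ξ s * phi ν s :=
    intervalIntegral.integral_nonneg zero_le_one fun s hs =>
      mul_nonneg (hξ.nonneg hs) (phi_nonneg ν hs.2)
  have h2 : 0 ≤ ∫ s in (0 : ℝ)..q, (1 / phi ν s - 1 / (1 - s)) :=
    intervalIntegral.integral_nonneg hq0 fun s hs =>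
      one_div_sub_nonneg hν (hs.2.trans_lt hq1) (phi_pos_of_le hν hpos hs.2)
  have h3 : 0 ≤ h ^ 2 * phi ν 0 := mul_nonneg (sq_nonneg h) (phi_nonneg ν zero_le_one)
  rw [primalReal, ENNReal.ofReal_add (add_nonneg h1 h2) h3, ENNReal.ofReal_add h1 h2,
    lintegral_deriv2_mul_phi hξ hν, lintegral_Ioc_inv_sub hν hq0 hq1 hpos]

lemma ofReal_primalReal_le (hξ : IsCovariance ξ R) {ν : Measure ℝ} (hν : ν ∈ prUnit) {q : ℝ}
    (hq0 : 0 ≤ q) (hq1 : q < 1) (hpos : 0 < phi ν q) :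
    ENNReal.ofReal (primalReal ξ h q (phi ν)) ≤ 2 * primal ξ h ν := by
  rw [ofReal_primalReal hξ hν hq0 hq1 hpos, two_mul_primal]
  gcongr

lemma two_mul_primal_eq (hξ : IsCovariance ξ R) {ν : Measure ℝ} (hν : ν ∈ prUnit) {q : ℝ}
    (hq0 : 0 ≤ q) (hq1 : q < 1) (hq : ν (Ioi q) = 0) :
    2 * primal ξ h ν = ENNReal.ofReal (primalReal ξ h q (phi ν)) := by
  have hpos : 0 < phi ν q := phi_pos_of_measure_Ioi hν hq hq1 hq1
  rw [ofReal_primalReal hξ hν hq0 hq1 hpos, two_mul_primal]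
  congr 2
  rw [← Ioc_union_Ioo_eq_Ioo hq0 hq1, lintegral_union measurableSet_Ioo]
  · have : ∫⁻ s in Ioo q 1, ((ENNReal.ofReal (phi ν s))⁻¹ - (ENNReal.ofReal (1 - s))⁻¹) = 0 := by
      rw [setLIntegral_congr_fun (g := fun _ => 0) measurableSet_Ioo]
      · simp
      · intro s hs
        simp only [phi_eq_one_sub hν hq hs.1.le hs.2.le, tsub_self]
    rw [this, add_zero]
  · refine disjoint_left.2 fun s hs hs' => ?_
    exact (hs'.1.trans_le hs.2).false

lemma primalReal_nonneg (hξ : IsCovariance ξ R) {ν : Measure ℝ} (hν : ν ∈ prUnit) {q : ℝ}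
    (hq0 : 0 ≤ q) (hq1 : q < 1) (hpos : 0 < phi ν q) : 0 ≤ primalReal ξ h q (phi ν) := by
  have := hν.1
  have h1 : 0 ≤ ∫ s in (0 : ℝ)..1, iteratedDeriv 2 ξ s * phi ν s :=
    intervalIntegral.integral_nonneg zero_le_one fun s hs =>
      mul_nonneg (hξ.nonneg hs) (phi_nonneg ν hs.2)
  have h2 : 0 ≤ ∫ s in (0 : ℝ)..q, (1 / phi ν s - 1 / (1 - s)) :=
    intervalIntegral.integral_nonneg hq0 fun s hs =>
      one_div_sub_nonneg hν (hs.2.trans_lt hq1) (phi_pos_of_le hν hpos hs.2)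
  exact add_nonneg (add_nonneg h1 h2) (mul_nonneg (sq_nonneg h) (phi_nonneg ν zero_le_one))

variable {μ : Measure ℝ}

lemma primalReal_le_of_isMinOn (hξ : IsCovariance ξ R) (hμ : μ ∈ prUnit)
    (hmin : IsMinOn (primal ξ h) prUnit μ) {ν : Measure ℝ} (hν : ν ∈ prUnit) {q : ℝ}
    (hq0 : 0 ≤ q) (hq1 : q < 1) (hpos : 0 < phi μ q) (hq : ν (Ioi q) = 0) :
    primalReal ξ h q (phi μ) ≤ primalReal ξ h q (phi ν) := by
  have h1 : ENNReal.ofReal (primalReal ξ h q (phi μ)) ≤ ENNReal.ofReal (primalReal ξ h q (phi ν)) := by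
    rw [← two_mul_primal_eq hξ hν hq0 hq1 hq]
    refine (ofReal_primalReal_le hξ hμ hq0 hq1 hpos).trans ?_
    gcongr
    exact hmin hν
  rwa [ENNReal.ofReal_le_ofReal_iff] at h1
  exact primalReal_nonneg hξ hν hq0 hq1 (phi_pos_of_measure_Ioi hν hq hq1 hq1)

lemma phi_pos_of_isMinOn (hξ : IsCovariance ξ R) (hμ : μ ∈ prUnit)
    (hmin : IsMinOn (primal ξ h) prUnit μ) {t : ℝ} (ht : t < 1) : 0 < phi μ t := by
  have := hμ.1
  wlog ht0 : 0 ≤ t generalizing t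
  · exact phi_pos_of_le hμ (this zero_lt_one le_rfl) (not_le.1 ht0).le
  by_contra hneg
  have hδ : Measure.dirac (0 : ℝ) ∈ prUnit := dirac_mem_prUnit (left_mem_Icc.2 zero_le_one)
  have hfin : 2 * primal ξ h μ ≠ ∞ := by
    have h1 : 2 * primal ξ h μ ≤ 2 * primal ξ h (Measure.dirac 0) := by
      gcongr
      exact hmin hδ
    rw [two_mul_primal_eq hξ hδ le_rfl zero_lt_one (by simp)] at h1
    exact ne_top_of_le_ne_top ENNReal.ofReal_ne_top h1
  refine hfin ?_
  rw [two_mul_primal]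
  have h2 : ∫⁻ s in Ioo (0 : ℝ) 1, ((ENNReal.ofReal (phi μ s))⁻¹ - (ENNReal.ofReal (1 - s))⁻¹) = ∞ := by
    have h3 : ∫⁻ s in Ioo t 1, ((ENNReal.ofReal (phi μ s))⁻¹ - (ENNReal.ofReal (1 - s))⁻¹) = ∞ := by
      rw [setLIntegral_congr_fun (g := fun _ => ∞) measurableSet_Ioo]
      · simp [ht]
      · intro s hs
        have h4 : phi μ s ≤ 0 := by linarith [phi_sub_phi_nonneg μ hs.1.le]
        have h5 : (ENNReal.ofReal (1 - s))⁻¹ ≠ ∞ := by simpa using hs.2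
        simp only [ENNReal.ofReal_of_nonpos h4, ENNReal.inv_zero]
        exact ENNReal.top_sub h5
    exact top_le_iff.1 (h3.symm.le.trans (lintegral_mono_set (Ioo_subset_Ioo_left ht0)))
  simp [h2]

/-- The truncation of `μ` at level `q`: the mass above `q` is moved to `q`. -/
lemma phi_map_min (hμ : μ ∈ prUnit) {q : ℝ} (hq0 : 0 ≤ q) (hq1 : q ≤ 1) :
    μ.map (fun x => min x q) ∈ prUnit ∧ (μ.map fun x => min x q) (Ioi q) = 0 ∧
      ∀ t ≤ q, phi (μ.map fun x => min x q) t = phi μ t + (1 - q - phi μ q) := by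
  have := hμ.1
  have hm : Measurable fun x : ℝ => min x q := measurable_id.min measurable_const
  have hq : (μ.map fun x => min x q) (Ioi q) = 0 := by
    rw [Measure.map_apply hm measurableSet_Ioi]
    simp [preimage]
  have hν : μ.map (fun x => min x q) ∈ prUnit := by
    refine ⟨Measure.isProbabilityMeasure_map hm.aemeasurable, ?_⟩
    rw [Measure.map_apply hm measurableSet_Icc.compl]
    refine measure_mono_null ?_ hμ.2
    intro x hx hx'
    exact hx ⟨le_min hx'.1 hq0, (min_le_left _ _).trans hx'.2⟩
  refine ⟨hν, hq, fun t ht => ?_⟩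
  have := hν.1
  have h1 : phi (μ.map fun x => min x q) t - phi (μ.map fun x => min x q) q
      = phi μ t - phi μ q := by
    rw [phi_sub_phi, phi_sub_phi]
    refine intervalIntegral.integral_congr_ae ?_
    filter_upwards [Measure.ae_ne volume q] with s hs hsm
    rw [uIoc_of_le ht] at hsm
    have hsq : s < q := lt_of_le_of_ne hsm.2 hs
    rw [measureReal_def, measureReal_def, Measure.map_apply hm measurableSet_Icc]
    congr 2
    ext x
    simp only [mem_preimage, mem_Icc, le_min_iff, min_le_iff]
    constructor
    · rintro ⟨⟨h1, _⟩, h2 | h2⟩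
      · exact ⟨h1, h2⟩
      · exact absurd h2 (not_le.2 hsq)
    · rintro ⟨h1, h2⟩
      exact ⟨⟨h1, hq0⟩, Or.inl h2⟩
  rw [phi_eq_one_sub hν hq le_rfl hq1] at h1
  linarith

lemma integral_one_div_one_sub_sq {q : ℝ} (hq0 : 0 ≤ q) (hq1 : q < 1) :
    ∫ s in (0 : ℝ)..q, 1 / (1 - s) ^ 2 = 1 / (1 - q) - 1 := by
  have hne : ∀ s ∈ uIcc 0 q, 1 - s ≠ 0 := fun s hs => by
    rw [uIcc_of_le hq0] at hs
    linarith [hs.2]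
  rw [intervalIntegral.integral_eq_sub_of_hasDerivAt (f := fun s => (1 - s)⁻¹)]
  · simp
  · intro s hs
    convert! ((hasDerivAt_id s).const_sub 1).inv (hne s hs) using 1
    simp
  · refine ContinuousOn.intervalIntegrable ?_
    exact continuousOn_const.div (by fun_prop) fun s hs => pow_ne_zero 2 (hne s hs)

/-- The support of a minimizer stays away from `1`: moving the mass beyond a level `q` close to `1`
to `q` lowers the entropic term `∫ 1/φ` by more than it raises the energy. -/
lemma exists_measure_Ioi_eq_zero (hξ : IsCovariance ξ R) (hμ : μ ∈ prUnit)
    (hmin : IsMinOn (primal ξ h) prUnit μ) : ∃ Q, 0 ≤ Q ∧ Q < 1 ∧ μ (Ioi Q) = 0 := by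
  have := hμ.1
  set M := ∫ s in (0 : ℝ)..1, iteratedDeriv 2 ξ s with hM
  have hM0 : 0 ≤ M := intervalIntegral.integral_nonneg zero_le_one fun s hs => hξ.nonneg hs
  have hD : 0 < M + h ^ 2 + 2 := by positivity
  -- Raising `φ` by `c` on `[0,q]` costs at most `(M + h²) c` and gains at least
  -- `c ∫₀^q (1-s)⁻² ds = (1/(1-q) - 1) c`; this `q` makes the gain exceed the cost by `c`.
  set q := 1 - 1 / (M + h ^ 2 + 2) with hq
  have hq1 : q < 1 := by
    have : 0 < 1 / (M + h ^ 2 + 2) := by positivity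
    linarith
  have hq0 : 0 ≤ q := by
    have : 1 / (M + h ^ 2 + 2) ≤ 1 := by
      rw [div_le_one hD]; nlinarith [sq_nonneg h]
    linarith
  obtain ⟨hν, hνq, hφν⟩ := phi_map_min hμ hq0 hq1.le
  set ν := μ.map fun x => min x q
  have := hν.1
  set c := 1 - q - phi μ q with hc
  have hposμ : ∀ s < 1, 0 < phi μ s := fun s hs => phi_pos_of_isMinOn hξ hμ hmin hs
  have hc0 : 0 ≤ c := by linarith [phi_le μ hq1.le]
  have hle := primalReal_le_of_isMinOn hξ hμ hmin hν hq0 hq1 (hposμ q hq1) hνq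
  have hposν : ∀ s < 1, 0 < phi ν s := fun s hs => phi_pos_of_measure_Ioi hν hνq hq1 hs
  have h1 : (∫ s in (0 : ℝ)..1, iteratedDeriv 2 ξ s * phi ν s)
      ≤ (∫ s in (0 : ℝ)..1, iteratedDeriv 2 ξ s * phi μ s) + M * c := by
    rw [hM, ← intervalIntegral.integral_mul_const, ← intervalIntegral.integral_add]
    · refine intervalIntegral.integral_mono_on zero_le_one ?_ ?_ ?_
      · exact intervalIntegrable_deriv2_mul hξ (continuous_phi ν) (by simp) (by simp)
      · exact (intervalIntegrable_deriv2_mul hξ (continuous_phi μ) (by simp) (by simp)).add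
          (intervalIntegrable_deriv2_mul hξ continuous_const (by simp) (by simp))
      · intro s hs
        rw [← mul_add]
        refine mul_le_mul_of_nonneg_left ?_ (hξ.nonneg hs)
        rcases le_total s q with h | h
        · exact (hφν s h).le
        · have := phi_sub_phi_le μ h
          rw [phi_eq_one_sub hν hνq h hs.2]
          linarith
    · exact intervalIntegrable_deriv2_mul hξ (continuous_phi μ) (by simp) (by simp)
    · exact intervalIntegrable_deriv2_mul hξ continuous_const (by simp) (by simp)
  have hsq : IntervalIntegrable (fun s : ℝ => c * (1 / (1 - s) ^ 2)) volume 0 q := by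
    refine ContinuousOn.intervalIntegrable_of_Icc hq0 ?_
    refine continuousOn_const.mul (continuousOn_const.div (by fun_prop) fun s hs => ?_)
    have := hs.2
    exact pow_ne_zero 2 (by linarith)
  have h2 : (∫ s in (0 : ℝ)..q, (1 / phi ν s - 1 / (1 - s)))
      ≤ (∫ s in (0 : ℝ)..q, (1 / phi μ s - 1 / (1 - s))) - c * (1 / (1 - q) - 1) := by
    have hiμ := intervalIntegrable_inv_sub (continuous_phi μ) hq0 hq1
      fun s hs => hposμ s (hs.2.trans_lt hq1)
    rw [← integral_one_div_one_sub_sq hq0 hq1, ← intervalIntegral.integral_const_mul,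
      ← intervalIntegral.integral_sub hiμ hsq]
    refine intervalIntegral.integral_mono_on hq0 (intervalIntegrable_inv_sub (continuous_phi ν) hq0
      hq1 fun s hs => hposν s (hs.2.trans_lt hq1)) (hiμ.sub hsq) fun s hs => ?_
    have hs1 : s < 1 := hs.2.trans_lt hq1
    have ha := hposμ s hs1
    have hb := hposν s hs1
    have hba : phi ν s - phi μ s = c := by rw [hφν s hs.2]; ring
    have h3 : 1 / phi μ s - 1 / phi ν s = c * (1 / (phi μ s * phi ν s)) := by
      rw [← hba]; field_simp
    have h4 : 1 / (1 - s) ^ 2 ≤ 1 / (phi μ s * phi ν s) := by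
      refine one_div_le_one_div_of_le (mul_pos ha hb) ?_
      rw [sq]
      exact mul_le_mul (phi_le μ hs1.le) (phi_le ν hs1.le) hb.le (sub_pos.2 hs1).le
    have h5 := mul_le_mul_of_nonneg_left h4 hc0
    linarith
  have h3 : h ^ 2 * phi ν 0 = h ^ 2 * phi μ 0 + h ^ 2 * c := by rw [hφν 0 hq0]; ring
  have h4 : 1 / (1 - q) = M + h ^ 2 + 2 := by rw [hq]; field_simp; ring
  rw [h4] at h2
  simp only [primalReal] at hle
  have hc' : c ≤ 0 := by nlinarith
  refine ⟨(q + 1) / 2, by linarith, by linarith, ?_⟩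
  exact measure_Ioi_eq_zero hμ (q := q) (by linarith) (by linarith) (by linarith)

lemma inv_add_sub_inv_le {a d ε δ : ℝ} (hδ : 0 < δ) (ha : δ ≤ a) (hb : δ ≤ a + ε * d)
    (hd : |d| ≤ 1) : 1 / (a + ε * d) - 1 / a ≤ -ε * (1 / a ^ 2 * d) + ε ^ 2 * (1 / δ ^ 3) := by
  have ha0 : 0 < a := hδ.trans_le ha
  have hb0 : 0 < a + ε * d := hδ.trans_le hb
  have h1 : 1 / (a + ε * d) - 1 / a + ε * (1 / a ^ 2 * d) = ε ^ 2 * (d ^ 2 / (a ^ 2 * (a + ε * d))) := by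
    field_simp
    ring
  have h2 : d ^ 2 / (a ^ 2 * (a + ε * d)) ≤ 1 / δ ^ 3 := by
    have h3 : d ^ 2 ≤ 1 := by rw [← sq_abs]; nlinarith [abs_nonneg d]
    have h4 : δ ^ 3 ≤ a ^ 2 * (a + ε * d) := by
      rw [pow_succ]; gcongr
    gcongr
  have := mul_le_mul_of_nonneg_left h2 (sq_nonneg ε)
  linarith

/-- The first-order condition for a minimizer, tested against the point mass at `r`. -/
lemma firstOrder (hξ : IsCovariance ξ R) (hμ : μ ∈ prUnit) (hmin : IsMinOn (primal ξ h) prUnit μ)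
    {Q r : ℝ} (hQ1 : Q < 1) (hQ : μ (Ioi Q) = 0) (hr : r ∈ Icc 0 Q) :
    0 ≤ (∫ s in (0 : ℝ)..Q, (iteratedDeriv 2 ξ s - 1 / phi μ s ^ 2) *
        (phi (Measure.dirac r) s - phi μ s)) + h ^ 2 * (phi (Measure.dirac r) 0 - phi μ 0) := by
  have := hμ.1
  have hQ0 : 0 ≤ Q := hr.1.trans hr.2
  have hδ : Measure.dirac r ∈ prUnit := dirac_mem_prUnit ⟨hr.1, hr.2.trans hQ1.le⟩
  have hδQ : Measure.dirac r (Ioi Q) = 0 := by simp [hr.2]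
  set ψ := phi (Measure.dirac r) with hψ
  set φ := phi μ with hφ
  have hφc : Continuous φ := continuous_phi μ
  have hψc : Continuous ψ := continuous_phi _
  have hdc : Continuous fun s => ψ s - φ s := hψc.sub hφc
  have hφQ : ∀ s ≤ Q, 1 - Q ≤ φ s := fun s hs => by
    have := phi_sub_phi_nonneg μ hs
    rw [phi_eq_one_sub hμ hQ le_rfl hQ1.le] at this
    linarith
  have hψQ : ∀ s ≤ Q, 1 - Q ≤ ψ s := fun s hs => by
    have := phi_sub_phi_nonneg (Measure.dirac r) hs
    rw [phi_eq_one_sub hδ hδQ le_rfl hQ1.le] at this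
    linarith
  have hQ' : 0 < 1 - Q := sub_pos.2 hQ1
  set A := (∫ s in (0 : ℝ)..1, iteratedDeriv 2 ξ s * (ψ s - φ s)) with hA
  set B := (∫ s in (0 : ℝ)..Q, 1 / φ s ^ 2 * (ψ s - φ s)) with hB
  set C := Q * (1 / (1 - Q) ^ 3) with hC
  have hBint : IntervalIntegrable (fun s => 1 / φ s ^ 2 * (ψ s - φ s)) volume 0 Q := by
    refine ContinuousOn.intervalIntegrable_of_Icc hQ0 ?_
    refine ContinuousOn.mul ?_ (hψc.sub hφc).continuousOn
    exact continuousOn_const.div (hφc.pow 2).continuousOn fun s hs =>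
      pow_ne_zero 2 (hQ'.trans_le (hφQ s hs.2)).ne'
  have key : ∀ ε ∈ Ioc (0 : ℝ) 1, 0 ≤ A - B + h ^ 2 * (ψ 0 - φ 0) + ε * C := by
    intro ε hε
    have hρ := mixture_mem_prUnit hμ hδ hε.1.le hε.2
    have hρQ : (ENNReal.ofReal (1 - ε) • μ + ENNReal.ofReal ε • Measure.dirac r) (Ioi Q) = 0 := by
      simp [hQ, hr.2]
    have hle := primalReal_le_of_isMinOn hξ hμ hmin hρ hQ0 hQ1 (hQ'.trans_le (hφQ Q le_rfl)) hρQ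
    have hmix : phi (ENNReal.ofReal (1 - ε) • μ + ENNReal.ofReal ε • Measure.dirac r)
        = fun s => φ s + ε * (ψ s - φ s) := by
      ext s
      rw [phi_mixture μ _ hε.1.le hε.2]
      ring
    rw [hmix] at hle
    have hmixc : Continuous fun s => φ s + ε * (ψ s - φ s) := by fun_prop
    have hmixQ : ∀ s ≤ Q, 1 - Q ≤ φ s + ε * (ψ s - φ s) := fun s hs => by
      have h1 := mul_le_mul_of_nonneg_left (hφQ s hs) (sub_nonneg.2 hε.2)
      have h2 := mul_le_mul_of_nonneg_left (hψQ s hs) hε.1.le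
      linarith
    simp only [primalReal] at hle
    have h1 : ∫ s in (0 : ℝ)..1, iteratedDeriv 2 ξ s * (φ s + ε * (ψ s - φ s))
        = (∫ s in (0 : ℝ)..1, iteratedDeriv 2 ξ s * φ s) + ε * A := by
      rw [hA, ← intervalIntegral.integral_const_mul, ← intervalIntegral.integral_add]
      · refine intervalIntegral.integral_congr fun s _ => ?_
        ring
      · exact intervalIntegrable_deriv2_mul hξ hφc (by simp) (by simp)
      · exact (intervalIntegrable_deriv2_mul hξ hdc (by simp) (by simp)).const_mul ε
    have h2 : (∫ s in (0 : ℝ)..Q, (1 / (φ s + ε * (ψ s - φ s)) - 1 / (1 - s)))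
        ≤ (∫ s in (0 : ℝ)..Q, (1 / φ s - 1 / (1 - s))) + (-ε * B + ε ^ 2 * C) := by
      have hi1 := intervalIntegrable_inv_sub hφc hQ0 hQ1 fun s hs => hQ'.trans_le (hφQ s hs.2)
      have hi2 : IntervalIntegrable (fun s => -ε * (1 / φ s ^ 2 * (ψ s - φ s))
          + ε ^ 2 * (1 / (1 - Q) ^ 3)) volume 0 Q :=
        (hBint.const_mul _).add intervalIntegrable_const
      have h3 : -ε * B + ε ^ 2 * C = ∫ s in (0 : ℝ)..Q, (-ε * (1 / φ s ^ 2 * (ψ s - φ s))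
          + ε ^ 2 * (1 / (1 - Q) ^ 3)) := by
        rw [intervalIntegral.integral_add (hBint.const_mul _) intervalIntegrable_const,
          intervalIntegral.integral_const_mul, intervalIntegral.integral_const, hC]
        simp only [smul_eq_mul, sub_zero]
        ring
      rw [h3, ← intervalIntegral.integral_add hi1 hi2]
      refine intervalIntegral.integral_mono_on hQ0 (intervalIntegrable_inv_sub hmixc hQ0 hQ1
        fun s hs => hQ'.trans_le (hmixQ s hs.2)) (hi1.add hi2) fun s hs => ?_
      have hd : |ψ s - φ s| ≤ 1 := by
        have hs1 : s ≤ 1 := hs.2.trans hQ1.le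
        have e1 := phi_le μ hs1
        have e2 := phi_le (Measure.dirac r) hs1
        have e3 := phi_nonneg μ hs1
        have e4 := phi_nonneg (Measure.dirac r) hs1
        rw [abs_le]
        constructor <;> linarith [hs.1]
      linarith [inv_add_sub_inv_le hQ' (hφQ s hs.2) (hmixQ s hs.2) hd]
    have h3 : 0 ≤ ε * (A - B + h ^ 2 * (ψ 0 - φ 0) + ε * C) := by
      rw [h1] at hle
      linarith
    exact nonneg_of_mul_nonneg_right h3 hε.1
  have hlim : 0 ≤ A - B + h ^ 2 * (ψ 0 - φ 0) := by
    have ht : Filter.Tendsto (fun ε : ℝ => A - B + h ^ 2 * (ψ 0 - φ 0) + ε * C) (𝓝[>] 0)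
        (𝓝 (A - B + h ^ 2 * (ψ 0 - φ 0) + 0 * C)) :=
      (Continuous.tendsto (by fun_prop) 0).mono_left nhdsWithin_le_nhds
    rw [zero_mul, add_zero] at ht
    refine ge_of_tendsto ht ?_
    filter_upwards [Ioc_mem_nhdsGT (zero_lt_one (α := ℝ))] with ε hε using key ε hε
  have hQm : Q ∈ Icc (0 : ℝ) 1 := ⟨hQ0, hQ1.le⟩
  have hi0 := intervalIntegrable_deriv2_mul hξ hdc (a := 0) (b := Q) (by simp) hQm
  have hA' : A = ∫ s in (0 : ℝ)..Q, iteratedDeriv 2 ξ s * (ψ s - φ s) := by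
    rw [hA, ← intervalIntegral.integral_add_adjacent_intervals (b := Q) hi0
      (intervalIntegrable_deriv2_mul hξ hdc hQm (by simp))]
    have : ∫ s in Q..1, iteratedDeriv 2 ξ s * (ψ s - φ s) = 0 := by
      rw [intervalIntegral.integral_congr (g := fun _ => (0 : ℝ))]
      · simp
      · intro s hs
        rw [uIcc_of_le hQ1.le] at hs
        simp only [hψ, hφ, phi_eq_one_sub hμ hQ hs.1 hs.2, phi_eq_one_sub hδ hδQ hs.1 hs.2,
          sub_self, mul_zero]
    rw [this, add_zero]
  simp only [sub_mul]
  rw [intervalIntegral.integral_sub hi0 hBint, ← hA', ← hB]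
  exact hlim

end

section

/-! ### The dual certificate of a minimizer -/

/-- A dual certificate for `μ`: a function `e ≥ ξ` with `e'(0) = -h²` and `e'' = 1/φ_μ²` which
touches `ξ` at `μ`-almost every point. The function `e1` is its derivative. -/
structure IsCertificate (ξ : ℝ → ℝ) (h : ℝ) (μ : Measure ℝ) (e e1 : ℝ → ℝ) : Prop where
  hasDerivAt : ∀ t < 1, HasDerivAt e (e1 t) t
  hasDerivAt_deriv : ∀ t < 1, HasDerivAt e1 (1 / phi μ t ^ 2) t
  deriv_zero : e1 0 = -h ^ 2
  le : ∀ t ∈ Ico (0 : ℝ) 1, ξ t ≤ e t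
  ae_eq : ∀ᵐ r ∂μ, e r = ξ r

lemma hasDerivAt_integral_of_continuousOn_Iio {g : ℝ → ℝ} (hg : ContinuousOn g (Iio 1)) {t : ℝ}
    (ht : t < 1) : HasDerivAt (fun s => ∫ u in (0 : ℝ)..s, g u) (g t) t := by
  refine intervalIntegral.integral_hasDerivAt_right ?_ ?_ (hg.continuousAt (Iio_mem_nhds ht))
  · refine (hg.mono fun u hu => ?_).intervalIntegrable
    rw [mem_uIcc] at hu
    rcases hu with hu | hu
    · exact hu.2.trans_lt ht
    · exact hu.2.trans_lt zero_lt_one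
  · exact hg.stronglyMeasurableAtFilter isOpen_Iio t ht

lemma eq_add_integral_of_hasDerivAt {f f' : ℝ → ℝ} {Q : ℝ}
    (hf : ∀ t ∈ Icc 0 Q, HasDerivAt f (f' t) t) (hf' : ContinuousOn f' (Icc 0 Q)) :
    ∀ s ∈ Icc 0 Q, f s = f 0 + ∫ u in (0 : ℝ)..s, f' u := fun s hs => by
  have hsub : uIcc 0 s ⊆ Icc 0 Q := by
    rw [uIcc_of_le hs.1]
    exact Icc_subset_Icc_right hs.2
  rw [intervalIntegral.integral_eq_sub_of_hasDerivAt (fun t ht => hf t (hsub ht))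
    (hf'.mono hsub).intervalIntegrable]
  ring

variable {ξ : ℝ → ℝ} {R h : ℝ} {μ : Measure ℝ}

lemma exists_isCertificate (hξ : IsCovariance ξ R) (hμ : μ ∈ prUnit)
    (hmin : IsMinOn (primal ξ h) prUnit μ) {Q : ℝ} (hQ0 : 0 ≤ Q) (hQ1 : Q < 1)
    (hQ : μ (Ioi Q) = 0) : ∃ e e1, IsCertificate ξ h μ e e1 := by
  have := hμ.1
  have hφ : ∀ s < 1, 0 < phi μ s := fun s hs => phi_pos_of_measure_Ioi hμ hQ hQ1 hs
  have hgc : ContinuousOn (fun s => 1 / phi μ s ^ 2) (Iio 1) :=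
    continuousOn_const.div ((continuous_phi μ).pow 2).continuousOn fun s hs =>
      pow_ne_zero 2 (hφ s hs).ne'
  set e1 : ℝ → ℝ := fun s => -h ^ 2 + ∫ u in (0 : ℝ)..s, 1 / phi μ u ^ 2 with he1
  have hd1 : ∀ t < 1, HasDerivAt e1 (1 / phi μ t ^ 2) t := fun t ht =>
    (hasDerivAt_integral_of_continuousOn_Iio hgc ht).const_add _
  have he1c : ContinuousOn e1 (Iio 1) := fun t ht => (hd1 t ht).continuousAt.continuousWithinAt
  set e : ℝ → ℝ := fun s => ∫ u in (0 : ℝ)..s, e1 u with he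
  have hd : ∀ t < 1, HasDerivAt e (e1 t) t := fun t ht =>
    hasDerivAt_integral_of_continuousOn_Iio he1c ht
  have he10 : e1 0 = -h ^ 2 := by simp [he1]
  set k : ℝ → ℝ := fun s => e s - ξ s with hk
  have hkd : ∀ t ∈ Ico (0 : ℝ) 1, HasDerivAt k (e1 t - deriv ξ t) t := fun t ht =>
    (hd t ht.2).sub (hξ.hasDerivAt ⟨ht.1, ht.2.le⟩)
  have hkd1 : ∀ t ∈ Ico (0 : ℝ) 1, HasDerivAt (fun t => e1 t - deriv ξ t)
      (1 / phi μ t ^ 2 - iteratedDeriv 2 ξ t) t := fun t ht =>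
    (hd1 t ht.2).sub (hξ.hasDerivAt_deriv ⟨ht.1, ht.2.le⟩)
  have hwc : ContinuousOn (fun t => 1 / phi μ t ^ 2 - iteratedDeriv 2 ξ t) (Ico 0 1) :=
    (hgc.mono fun s hs => hs.2).sub (hξ.continuousOn_deriv2.mono Ico_subset_Icc_self)
  have hkint : Integrable k μ := integrable_of_continuousOn hμ hQ fun t ht =>
    (hkd t ⟨ht.1, ht.2.trans_lt hQ1⟩).continuousAt.continuousWithinAt
  set c := ∫ r, k r ∂μ with hc
  have hle : ∀ r ∈ Ico (0 : ℝ) 1, c ≤ k r := fun r hr => by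
    have hQ'1 : max Q r < 1 := max_lt hQ1 hr.2
    have hQ'0 : 0 ≤ max Q r := le_max_of_le_left hQ0
    have hsub : Icc 0 (max Q r) ⊆ Ico 0 1 := fun t ht => ⟨ht.1, ht.2.trans_lt hQ'1⟩
    have hμQ' : μ (Ioi (max Q r)) = 0 := measure_mono_null (Ioi_subset_Ioi (le_max_left Q r)) hQ
    have hdiff := integral_mul_phi_sub_phi (ν := Measure.dirac r)
      (dirac_mem_prUnit ⟨hr.1, hr.2.le⟩) hμ hQ'0 hQ'1.le (by simp) hμQ'
      ((hwc.mono hsub).intervalIntegrable_of_Icc hQ'0)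
      (eq_add_integral_of_hasDerivAt (fun t ht => hkd1 t (hsub ht)) (hwc.mono hsub))
      (eq_add_integral_of_hasDerivAt (fun t ht => hkd t (hsub ht)) fun t ht =>
        (hkd1 t (hsub ht)).continuousAt.continuousWithinAt)
    have hfo := firstOrder hξ hμ hmin hQ'1 hμQ' (r := r) ⟨hr.1, le_max_right Q r⟩
    have hneg : ∫ s in (0 : ℝ)..max Q r, (iteratedDeriv 2 ξ s - 1 / phi μ s ^ 2) *
        (phi (Measure.dirac r) s - phi μ s) = -∫ s in (0 : ℝ)..max Q r,
        (1 / phi μ s ^ 2 - iteratedDeriv 2 ξ s) * (phi (Measure.dirac r) s - phi μ s) := by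
      rw [← intervalIntegral.integral_neg]
      refine intervalIntegral.integral_congr fun s _ => ?_
      ring
    rw [hneg, hdiff, he10, hξ.deriv_zero, integral_dirac] at hfo
    linarith
  have hae : ∀ᵐ r ∂μ, k r - c = 0 := by
    have h0 : ∫ r, (k r - c) ∂μ = 0 := by
      rw [integral_sub hkint (integrable_const _)]
      simp [hc]
    refine (integral_eq_zero_iff_of_nonneg_ae ?_ (hkint.sub (integrable_const _))).1 h0
    filter_upwards [ae_mem_Icc hμ hQ] with r hr
    exact sub_nonneg.2 (hle r ⟨hr.1, hr.2.trans_lt hQ1⟩)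
  refine ⟨fun s => e s - c, e1, fun t ht => (hd t ht).sub_const c, hd1, he10, fun t ht => ?_, ?_⟩
  · have := hle t ht
    simp only [hk] at this
    linarith
  · filter_upwards [hae] with r hr
    simp only [hk] at hr
    linarith

namespace IsCertificate

variable {e e1 : ℝ → ℝ}

lemma d1_eq (he : IsCertificate ξ h μ e e1) : EqOn (d1 e) e1 (Ico 0 1) := fun t ht =>
  (he.hasDerivAt t ht.2).hasDerivWithinAt.derivWithin (uniqueDiffOn_Ico 0 1 t ht)

lemma d2_eq (he : IsCertificate ξ h μ e e1) {t : ℝ} (ht : t ∈ Ico (0 : ℝ) 1) :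
    d2 e t = 1 / phi μ t ^ 2 := by
  rw [d2, derivWithin_congr he.d1_eq (he.d1_eq ht)]
  exact (he.hasDerivAt_deriv t ht.2).hasDerivWithinAt.derivWithin (uniqueDiffOn_Ico 0 1 t ht)

lemma mem_admissible (he : IsCertificate ξ h μ e e1)
    (hφ : ContinuousOn (fun s => 1 / phi μ s ^ 2) (Iio 1)) : e ∈ admissible ξ h := by
  have hsub : Ico (0 : ℝ) 1 ⊆ Iio 1 := fun t ht => ht.2
  have hc1 : ContDiffOn ℝ 1 e1 (Ico 0 1) := by
    rw [contDiffOn_one_iff_derivWithin (uniqueDiffOn_Ico 0 1)]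
    exact ⟨fun t ht => (he.hasDerivAt_deriv t ht.2).differentiableAt.differentiableWithinAt,
      (hφ.mono hsub).congr fun t ht => (he.hasDerivAt_deriv t ht.2).hasDerivWithinAt.derivWithin
        (uniqueDiffOn_Ico 0 1 t ht)⟩
  have hc : ContDiffOn ℝ 1 e (Ico 0 1) := by
    rw [contDiffOn_one_iff_derivWithin (uniqueDiffOn_Ico 0 1)]
    exact ⟨fun t ht => (he.hasDerivAt t ht.2).differentiableAt.differentiableWithinAt,
      hc1.continuousOn.congr he.d1_eq⟩
  refine ⟨⟨hc, ?_⟩, he.le, ?_, ?_⟩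
  · exact (hc1.congr he.d1_eq).locallyLipschitzOn (convex_Ico 0 1)
  · rw [he.d1_eq ⟨le_rfl, zero_lt_one⟩, he.deriv_zero]
  · filter_upwards [ae_restrict_mem measurableSet_Ioo] with t ht
    rw [he.d2_eq (Ioo_subset_Ico_self ht)]
    positivity

end IsCertificate

end

section

/-! ### Maximizers of the dual functional -/

lemma ereal_dual_le {L₀ L : ℝ≥0∞} {c₀ c : ℝ} (hL₀ : L₀ ≠ ∞)
    (hle : ((1 / 2 : ℝ) : EReal) * (-(L₀ : EReal) + (c₀ : EReal))
      ≤ ((1 / 2 : ℝ) : EReal) * (-(L : EReal) + (c : EReal))) :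
    L ≠ ∞ ∧ L.toReal - c ≤ L₀.toReal - c₀ := by
  lift L₀ to NNReal using hL₀
  induction L with
  | top =>
    exfalso
    have h1 : ((1 / 2 : ℝ) : EReal) * (-((∞ : ℝ≥0∞) : EReal) + (c : EReal)) = ⊥ := by
      rw [EReal.coe_ennreal_top, EReal.neg_top, EReal.bot_add, EReal.coe_mul_bot_of_pos (by norm_num)]
    rw [h1, le_bot_iff] at hle
    have h2 : ((1 / 2 : ℝ) : EReal) * (-(((L₀ : NNReal) : ℝ≥0∞) : EReal) + (c₀ : EReal))
        = ((1 / 2 * (-(L₀ : ℝ) + c₀) : ℝ) : EReal) := by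
      norm_cast
    rw [h2] at hle
    exact EReal.coe_ne_bot _ hle
  | coe L =>
    refine ⟨ENNReal.coe_ne_top, ?_⟩
    have h3 : ∀ (x : NNReal) (y : ℝ), ((1 / 2 : ℝ) : EReal) * (-((x : ℝ≥0∞) : EReal) + (y : EReal))
        = ((1 / 2 * (-(x : ℝ) + y) : ℝ) : EReal) := fun x y => by
      norm_cast
    rw [h3, h3, EReal.coe_le_coe_iff] at hle
    simp only [ENNReal.coe_toReal]
    linarith

/-- The defect in the inequality `2√w ≤ w(1-s) + 1/(1-s)`. -/
noncomputable def defect (w s : ℝ) : ℝ := -(2 * √w - w * (1 - s) - 1 / (1 - s))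

lemma defect_nonneg {w s : ℝ} (hw : 0 ≤ w) (hs : s < 1) : 0 ≤ defect w s := by
  have h1 : 0 < 1 - s := sub_pos.2 hs
  have h2 : defect w s = (1 - s) * (√w - 1 / (1 - s)) ^ 2 := by
    have h3 : -(2 * √w - √w ^ 2 * (1 - s) - 1 / (1 - s)) = (1 - s) * (√w - 1 / (1 - s)) ^ 2 := by
      field_simp
      ring
    rwa [Real.sq_sqrt hw] at h3
  rw [h2]
  positivity

/-- Completing the square: the gap in `2√w ≤ wφ + 1/φ`, compared with the defect at `w = 1/φ²`. -/
lemma defect_sub_defect {w s p : ℝ} (hp : 0 < p) :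
    defect w s - defect (1 / p ^ 2) s
      = (p * w - 2 * √w + 1 / p) - (w - 1 / p ^ 2) * (p - (1 - s)) := by
  have h : √(1 / p ^ 2) = 1 / p := by
    rw [Real.sqrt_div zero_le_one, Real.sqrt_one, Real.sqrt_sq hp.le]
  rw [defect, defect, h]
  field_simp
  ring

lemma gap_eq {w p : ℝ} (hw : 0 ≤ w) (hp : 0 < p) :
    p * w - 2 * √w + 1 / p = p * (√w - 1 / p) ^ 2 := by
  have h3 : p * √w ^ 2 - 2 * √w + 1 / p = p * (√w - 1 / p) ^ 2 := by
    field_simp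
    ring
  rwa [Real.sq_sqrt hw] at h3

variable {ξ : ℝ → ℝ} {R h : ℝ} {μ : Measure ℝ} {η e e1 : ℝ → ℝ}

lemma intervalIntegrable_d2 (hη : η ∈ spaceX) {Q : ℝ} (hQ0 : 0 ≤ Q) (hQ1 : Q < 1) :
    IntervalIntegrable (d2 η) volume 0 Q ∧
      ∀ s ∈ Icc 0 Q, d1 η s = d1 η 0 + ∫ u in (0 : ℝ)..s, d2 η u := by
  have hsub : Icc 0 Q ⊆ Ico 0 1 := fun t ht => ⟨ht.1, ht.2.trans_lt hQ1⟩
  obtain ⟨K, hK⟩ := (hη.2.mono hsub).exists_lipschitzOnWith_of_compact isCompact_Icc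
  have heq : ∀ s ∈ Ioo (0 : ℝ) 1, deriv (d1 η) s = d2 η s := fun s hs =>
    (derivWithin_of_mem_nhds (Ico_mem_nhds hs.1 hs.2)).symm
  have hac : ∀ s ∈ Icc 0 Q, AbsolutelyContinuousOnInterval (d1 η) 0 s := fun s hs => by
    refine LipschitzOnWith.absolutelyContinuousOnInterval (K := K) (hK.mono ?_)
    rw [uIcc_of_le hs.1]
    exact Icc_subset_Icc_right hs.2
  have hEq : ∀ s ∈ Icc 0 Q, ∀ u ∈ uIoc 0 s, deriv (d1 η) u = d2 η u := fun s hs u hu => by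
    rw [uIoc_of_le hs.1] at hu
    exact heq u ⟨hu.1, (hu.2.trans hs.2).trans_lt hQ1⟩
  constructor
  · exact (hac Q ⟨hQ0, le_rfl⟩).intervalIntegrable_deriv.congr (hEq Q ⟨hQ0, le_rfl⟩)
  · intro s hs
    have h1 := (hac s hs).integral_deriv_eq_sub
    rw [intervalIntegral.integral_congr_ae (g := d2 η)
      (Filter.Eventually.of_forall fun u hu => hEq s hs u hu)] at h1
    linarith

lemma eq_add_integral_d1 (hη : η ∈ spaceX) {Q : ℝ} (hQ1 : Q < 1) :
    ∀ s ∈ Icc 0 Q, η s = η 0 + ∫ u in (0 : ℝ)..s, d1 η u := fun s hs => by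
  have hsub : Icc 0 s ⊆ Ico 0 1 := fun t ht => ⟨ht.1, (ht.2.trans hs.2).trans_lt hQ1⟩
  have hc1 : ContinuousOn (d1 η) (Icc 0 s) := (hη.2.continuousOn).mono hsub
  rw [intervalIntegral.integral_eq_sub_of_hasDerivAt_of_le hs.1 (hη.1.continuousOn.mono hsub)
    (fun t ht => ?_) (hc1.intervalIntegrable_of_Icc hs.1)]
  · ring
  · have ht' := hsub (Ioo_subset_Icc_self ht)
    exact ((hη.1.differentiableOn one_ne_zero t ht').hasDerivWithinAt).hasDerivAt
      (Ico_mem_nhds ht.1 ht'.2)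

lemma intervalIntegrable_sqrt {w : ℝ → ℝ} {a b : ℝ} (hw : IntervalIntegrable w volume a b) :
    IntervalIntegrable (fun s => √(w s)) volume a b := by
  have h1 : IntervalIntegrable (fun s => 1 + |w s|) volume a b :=
    intervalIntegrable_const.add hw.abs
  refine h1.mono_fun ?_ (Filter.Eventually.of_forall fun s => ?_)
  · have h2 := hw.aestronglyMeasurable_restrict_uIoc
    exact Real.continuous_sqrt.comp_aestronglyMeasurable h2
  · dsimp only
    rw [Real.norm_of_nonneg (Real.sqrt_nonneg _), Real.norm_of_nonneg (by positivity)]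
    have h3 : √(w s) ≤ √|w s| := Real.sqrt_le_sqrt (le_abs_self _)
    nlinarith [Real.sq_sqrt (abs_nonneg (w s)), sq_nonneg (√|w s| - 1)]

lemma intervalIntegrable_defect {w : ℝ → ℝ} {Q : ℝ} (hQ0 : 0 ≤ Q) (hQ1 : Q < 1)
    (hw : IntervalIntegrable w volume 0 Q) :
    IntervalIntegrable (fun s => defect (w s) s) volume 0 Q := by
  have hc : IntervalIntegrable (fun s : ℝ => 1 / (1 - s)) volume 0 Q := by
    refine ContinuousOn.intervalIntegrable_of_Icc hQ0
      (continuousOn_const.div (by fun_prop) fun s hs => ?_)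
    exact (sub_pos.2 (hs.2.trans_lt hQ1)).ne'
  exact ((((intervalIntegrable_sqrt hw).const_mul 2).sub
    (hw.mul_continuousOn (g := fun s => 1 - s) (by fun_prop))).sub hc).neg

/-- A certificate for `μ` is the only maximizer of the dual functional: the dual value of `η`
falls short of that of `e` by `½ (∫ φ (√η'' - 1/φ)² + ∫ (η - ξ) dμ)`. -/
theorem IsCertificate.eqOn_of_isMaxOn (hμ : μ ∈ prUnit) (he : IsCertificate ξ h μ e e1)
    {Q₀ : ℝ} (hQ₀0 : 0 ≤ Q₀) (hQ₀1 : Q₀ < 1) (hQ₀ : μ (Ioi Q₀) = 0)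
    (hη : η ∈ admissible ξ h) (hmax : IsMaxOn (dual ξ h) (admissible ξ h) η) :
    EqOn η e (Ico 0 1) := by
  have := hμ.1
  intro r hr
  set Q := max Q₀ r with hQdef
  have hQ1 : Q < 1 := max_lt hQ₀1 hr.2
  have hQ0 : 0 ≤ Q := le_max_of_le_left hQ₀0
  have hQ : μ (Ioi Q) = 0 := measure_mono_null (Ioi_subset_Ioi (le_max_left Q₀ r)) hQ₀
  have hsub : Icc 0 Q ⊆ Ico 0 1 := fun t ht => ⟨ht.1, ht.2.trans_lt hQ1⟩
  have hQm : Q ∈ Icc 0 Q := ⟨hQ0, le_rfl⟩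
  have hφ : ∀ s < 1, 0 < phi μ s := fun s hs => phi_pos_of_measure_Ioi hμ hQ hQ1 hs
  have hgc : ContinuousOn (fun s => 1 / phi μ s ^ 2) (Iio 1) :=
    continuousOn_const.div ((continuous_phi μ).pow 2).continuousOn fun s hs =>
      pow_ne_zero 2 (hφ s hs).ne'
  have headm := he.mem_admissible hgc
  obtain ⟨hwi, hwη⟩ := intervalIntegrable_d2 hη.1 hQ0 hQ1
  obtain ⟨hw0i, hwe⟩ := intervalIntegrable_d2 headm.1 hQ0 hQ1
  have hnn : ∀ᵐ s ∂volume.restrict (Ioc 0 Q), 0 ≤ d2 η s := by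
    refine ae_mono (Measure.restrict_mono (fun s hs => ?_) le_rfl) hη.2.2.2
    exact ⟨hs.1, hs.2.trans_lt hQ1⟩
  have hmem : ∀ᵐ s ∂volume.restrict (Ioc 0 Q), s ∈ Ioc 0 Q := ae_restrict_mem measurableSet_Ioc
  set L : ℝ≥0∞ := ∫⁻ s in Ioo (0 : ℝ) 1, ENNReal.ofReal (defect (d2 η s) s) with hL
  set L₀ : ℝ≥0∞ := ∫⁻ s in Ioo (0 : ℝ) 1, ENNReal.ofReal (defect (d2 e s) s) with hL₀
  have hiη := intervalIntegrable_defect hQ0 hQ1 hwi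
  have hie := intervalIntegrable_defect hQ0 hQ1 hw0i
  have hLge : ENNReal.ofReal (∫ s in (0 : ℝ)..Q, defect (d2 η s) s) ≤ L := by
    rw [intervalIntegral.integral_of_le hQ0, ofReal_integral_eq_lintegral_ofReal hiη.1]
    · exact lintegral_mono_set fun s hs => ⟨hs.1, hs.2.trans_lt hQ1⟩
    · filter_upwards [hnn, hmem] with s hs hsm using defect_nonneg hs (hsm.2.trans_lt hQ1)
  have he2 : ∀ s ∈ Ico (0 : ℝ) 1, 0 ≤ d2 e s := fun s hs => by
    rw [he.d2_eq hs]; positivity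
  have hL₀eq : L₀ = ENNReal.ofReal (∫ s in (0 : ℝ)..Q, defect (d2 e s) s) := by
    rw [intervalIntegral.integral_of_le hQ0, ofReal_integral_eq_lintegral_ofReal hie.1, hL₀,
      ← Ioc_union_Ioo_eq_Ioo hQ0 hQ1, lintegral_union measurableSet_Ioo]
    · have : ∫⁻ s in Ioo Q 1, ENNReal.ofReal (defect (d2 e s) s) = 0 := by
        rw [setLIntegral_congr_fun (g := fun _ => 0) measurableSet_Ioo]
        · simp
        · intro s hs
          have hs1 : 0 < 1 - s := sub_pos.2 hs.2
          have h0 : defect (d2 e s) s = 0 := by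
            rw [he.d2_eq ⟨hQ0.trans hs.1.le, hs.2⟩, phi_eq_one_sub hμ hQ hs.1.le hs.2.le, defect,
              Real.sqrt_div zero_le_one, Real.sqrt_one, Real.sqrt_sq hs1.le]
            field_simp
            ring
          simp only [h0, ENNReal.ofReal_zero]
      rw [this, add_zero]
    · refine disjoint_left.2 fun s hs hs' => ?_
      exact (hs'.1.trans_le hs.2).false
    · filter_upwards [hmem] with s hsm
      exact defect_nonneg (he2 s ⟨hsm.1.le, hsm.2.trans_lt hQ1⟩) (hsm.2.trans_lt hQ1)
  obtain ⟨hLtop, hreal⟩ := ereal_dual_le (L₀ := L₀) (L := L) (c₀ := -e 0 + h ^ 2 + ξ 1)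
    (c := -η 0 + h ^ 2 + ξ 1) (hL₀eq ▸ ENNReal.ofReal_ne_top) (hmax headm)
  have hLge' : ∫ s in (0 : ℝ)..Q, defect (d2 η s) s ≤ L.toReal :=
    (ENNReal.ofReal_le_iff_le_toReal hLtop).1 hLge
  have hL₀' : L₀.toReal = ∫ s in (0 : ℝ)..Q, defect (d2 e s) s := by
    rw [hL₀eq, ENNReal.toReal_ofReal]
    exact intervalIntegral.integral_nonneg hQ0 fun s hs =>
      defect_nonneg (he2 s (hsub hs)) (hsub hs).2
  rw [hL₀'] at hreal
  -- The difference `k = η - e`, its derivatives, and integration by parts against `φ_μ - (1 - s)`.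
  set w : ℝ → ℝ := fun s => d2 η s - d2 e s with hw
  have hwint : IntervalIntegrable w volume 0 Q := hwi.sub hw0i
  have hk1 : ∀ s ∈ Icc 0 Q, d1 η s - d1 e s = (d1 η 0 - d1 e 0) + ∫ u in (0 : ℝ)..s, w u :=
    fun s hs => by
      have hs' : uIcc 0 s ⊆ uIcc 0 Q := by
        rw [uIcc_of_le hs.1, uIcc_of_le hQ0]; exact Icc_subset_Icc_right hs.2
      rw [hwη s hs, hwe s hs, intervalIntegral.integral_sub (hwi.mono_set hs') (hw0i.mono_set hs')]
      ring
  have hk : ∀ s ∈ Icc 0 Q, η s - e s = (η 0 - e 0) + ∫ u in (0 : ℝ)..s, (d1 η u - d1 e u) :=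
    fun s hs => by
      have hs' : Icc 0 s ⊆ Ico 0 1 := fun t ht => ⟨ht.1, (ht.2.trans hs.2).trans_lt hQ1⟩
      rw [eq_add_integral_d1 hη.1 hQ1 s hs, eq_add_integral_d1 headm.1 hQ1 s hs,
        intervalIntegral.integral_sub
          ((hη.1.2.continuousOn.mono hs').intervalIntegrable_of_Icc hs.1)
          ((headm.1.2.continuousOn.mono hs').intervalIntegrable_of_Icc hs.1)]
      ring
  have hδ : Measure.dirac (0 : ℝ) ∈ prUnit := dirac_mem_prUnit (left_mem_Icc.2 zero_le_one)
  have hparts := integral_mul_phi_sub_phi hμ hδ hQ0 hQ1.le hQ (by simp [hQ0]) hwint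
    (k1 := fun s => d1 η s - d1 e s) (k := fun s => η s - e s) hk1 hk
  have hk10 : d1 η 0 - d1 e 0 = 0 := by rw [hη.2.2.1, headm.2.2.1, sub_self]
  simp only [hk10, neg_zero, zero_mul, zero_add, integral_dirac] at hparts
  set G : ℝ → ℝ := fun s => phi μ s * d2 η s - 2 * √(d2 η s) + 1 / phi μ s with hG
  have hGint : IntervalIntegrable G volume 0 Q := by
    refine ((hwi.continuousOn_mul (continuous_phi μ).continuousOn).sub
      ((intervalIntegrable_sqrt hwi).const_mul 2)).add
      (ContinuousOn.intervalIntegrable_of_Icc hQ0 ?_)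
    exact continuousOn_const.div (continuous_phi μ).continuousOn fun s hs => (hφ s (hsub hs).2).ne'
  have hGnn : ∀ᵐ s ∂volume.restrict (Ioc 0 Q), 0 ≤ G s := by
    filter_upwards [hnn, hmem] with s hs hsm
    have hp := hφ s (hsm.2.trans_lt hQ1)
    simp only [hG, gap_eq hs hp]
    positivity
  have hdiff : (∫ s in (0 : ℝ)..Q, defect (d2 η s) s) - ∫ s in (0 : ℝ)..Q, defect (d2 e s) s
      = (∫ s in (0 : ℝ)..Q, G s)
        - ∫ s in (0 : ℝ)..Q, w s * (phi μ s - phi (Measure.dirac 0) s) := by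
    have hφd : Continuous fun s => phi μ s - phi (Measure.dirac 0) s :=
      (continuous_phi μ).sub (continuous_phi _)
    rw [← intervalIntegral.integral_sub hiη hie, ← intervalIntegral.integral_sub hGint
      (hwint.mul_continuousOn hφd.continuousOn)]
    refine intervalIntegral.integral_congr fun s hs => ?_
    rw [uIcc_of_le hQ0] at hs
    have h2 := he.d2_eq (hsub hs)
    simp only [hw, hG, h2]
    rw [defect_sub_defect (hφ s (hsub hs).2),
      phi_eq_one_sub hδ (Q := 0) (by simp) hs.1 (hsub hs).2.le]
  have hkae : ∀ᵐ s ∂μ, 0 ≤ η s - e s := by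
    filter_upwards [he.ae_eq, ae_mem_Icc hμ hQ] with s hs hsm
    rw [hs]
    exact sub_nonneg.2 (hη.2.1 s (hsub hsm))
  have hknn : 0 ≤ ∫ s, (η s - e s) ∂μ := integral_nonneg_of_ae hkae
  have hGi : 0 ≤ ∫ s in (0 : ℝ)..Q, G s := by
    rw [intervalIntegral.integral_of_le hQ0]
    exact integral_nonneg_of_ae hGnn
  have hG0 : ∫ s in (0 : ℝ)..Q, G s = 0 := by linarith
  have hk0 : ∫ s, (η s - e s) ∂μ = 0 := by linarith
  -- Both defects vanish, so `η'' = 1/φ²` almost everywhere and `η - e` is constant.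
  have hGae : ∀ᵐ s ∂volume.restrict (Ioc 0 Q), G s = 0 := by
    rw [intervalIntegral.integral_of_le hQ0] at hG0
    exact (integral_eq_zero_iff_of_nonneg_ae hGnn hGint.1).1 hG0
  have hwae : ∀ᵐ s ∂volume.restrict (Ioc 0 Q), w s = 0 := by
    filter_upwards [hGae, hnn, hmem] with s hs hsn hsm
    have hs1 : s < 1 := hsm.2.trans_lt hQ1
    have hp := hφ s hs1
    simp only [hG, gap_eq hsn hp] at hs
    have h1 : √(d2 η s) - 1 / phi μ s = 0 := by
      rcases mul_eq_zero.1 hs with h | h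
      · exact absurd h hp.ne'
      · exact pow_eq_zero_iff two_ne_zero |>.1 h
    have h2 : d2 η s = (1 / phi μ s) ^ 2 := by
      rw [← sub_eq_zero.1 h1, Real.sq_sqrt hsn]
    simp only [hw, he.d2_eq ⟨hsm.1.le, hs1⟩, h2]
    ring
  have hw0 : ∀ s ∈ Icc 0 Q, ∫ u in (0 : ℝ)..s, w u = 0 := fun s hs => by
    rw [intervalIntegral.integral_of_le hs.1]
    refine integral_eq_zero_of_ae ?_
    exact ae_mono (Measure.restrict_mono (Ioc_subset_Ioc_right hs.2) le_rfl) hwae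
  have hconst : ∀ s ∈ Icc 0 Q, η s - e s = η 0 - e 0 := fun s hs => by
    rw [hk s hs, intervalIntegral.integral_congr (g := fun _ => (0 : ℝ))]
    · simp
    · intro u hu
      rw [uIcc_of_le hs.1] at hu
      have hu' : u ∈ Icc 0 Q := ⟨hu.1, hu.2.trans hs.2⟩
      simp only [hk1 u hu', hk10, hw0 u hu', add_zero]
  have h0 : η 0 - e 0 = 0 := by
    rw [integral_congr_ae (g := fun _ => η 0 - e 0)] at hk0
    · simpa using hk0
    · filter_upwards [ae_mem_Icc hμ hQ] with s hs using hconst s hs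
  have := hconst r ⟨hr.1, le_max_right Q₀ r⟩
  linarith

end

section

/-! ### `φ_μ` on intervals without mass -/

lemma exists_phi_eq_affine {μ : Measure ℝ} [IsProbabilityMeasure μ] {u v : ℝ} (huv : u < v)
    (hnull : μ (Ioo u v) = 0) : ∃ c m : ℝ, ∀ s ∈ Icc u v, phi μ s = c - m * s := by
  set m := μ.real (Icc 0 ((u + v) / 2)) with hm
  have hmid : (u + v) / 2 ∈ Ioo u v := ⟨by linarith, by linarith⟩
  have hstep : ∀ s ∈ Ioo u v, ∀ t ∈ Ioo u v, μ.real (Icc 0 t) ≤ μ.real (Icc 0 s) :=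
    fun s hs t ht => by
      have hsub : Icc 0 t ⊆ Icc 0 s ∪ Ioo u v := fun x hx => by
        rcases le_or_gt x s with h | h
        · exact Or.inl ⟨hx.1, h⟩
        · exact Or.inr ⟨hs.1.trans h, hx.2.trans_lt ht.2⟩
      have h1 := measureReal_mono (μ := μ) hsub
      have h2 := measureReal_union_le (μ := μ) (Icc 0 s) (Ioo u v)
      have h3 : μ.real (Ioo u v) = 0 := by simp [measureReal_def, hnull]
      linarith
  have hconst : ∀ s ∈ Ioo u v, μ.real (Icc 0 s) = m := fun s hs =>
    le_antisymm (hstep _ hmid _ hs) (hstep _ hs _ hmid)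
  refine ⟨phi μ u + m * u, m, fun s hs => ?_⟩
  have h1 : phi μ u - phi μ s = (s - u) * m := by
    rw [phi_sub_phi, intervalIntegral.integral_congr_ae (g := fun _ => m)]
    · simp
    · filter_upwards [Measure.ae_ne volume v] with x hx hxm
      rw [uIoc_of_le hs.1] at hxm
      exact hconst x ⟨hxm.1, lt_of_le_of_ne (hxm.2.trans hs.2) hx⟩
  linarith

lemma measure_Ioo_eq_zero_of_affine {μ : Measure ℝ} [IsProbabilityMeasure μ] {u v c m : ℝ}
    (hu : 0 ≤ u) (hφ : ∀ s ∈ Ioo u v, phi μ s = c - m * s) : μ (Ioo u v) = 0 := by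
  have hbd : ∀ s ∈ Ioo u v, ∀ t ∈ Ioo u v, s < t →
      μ.real (Icc 0 s) ≤ m ∧ m ≤ μ.real (Icc 0 t) := fun s hs t ht hst => by
    have h1 : ∫ x in s..t, μ.real (Icc 0 x) = m * (t - s) := by
      rw [← phi_sub_phi, hφ s hs, hφ t ht]; ring
    have h2 := intervalIntegral.integral_mono_on hst.le
      (intervalIntegrable_const (c := μ.real (Icc 0 s))) (intervalIntegrable_cdf μ s t)
      fun x hx => monotone_cdf μ hx.1
    have h3 := intervalIntegral.integral_mono_on hst.le (intervalIntegrable_cdf μ s t)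
      (intervalIntegrable_const (c := μ.real (Icc 0 t))) fun x hx => monotone_cdf μ hx.2
    rw [h1, intervalIntegral.integral_const, smul_eq_mul] at h2 h3
    have hpos := sub_pos.2 hst
    constructor <;> nlinarith
  have hconst : ∀ s ∈ Ioo u v, μ.real (Icc 0 s) = m := fun s hs => by
    obtain ⟨a, ha1, ha2⟩ := exists_between hs.1
    obtain ⟨b, hb1, hb2⟩ := exists_between hs.2
    exact le_antisymm (hbd s hs b ⟨hs.1.trans hb1, hb2⟩ hb1).1
      (hbd a ⟨ha1, ha2.trans hs.2⟩ s hs ha2).2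
  refine measure_null_of_locally_null _ fun x hx => ?_
  obtain ⟨a, ha1, ha2⟩ := exists_between hx.1
  obtain ⟨b, hb1, hb2⟩ := exists_between hx.2
  refine ⟨Ioc a b, mem_nhdsWithin_of_mem_nhds (Ioc_mem_nhds ha2 hb1), ?_⟩
  have hab : a ≤ b := (ha2.trans hb1).le
  have hdiff : Icc 0 b \ Icc 0 a = Ioc a b := by
    ext y
    simp only [mem_sdiff, mem_Icc, mem_Ioc, not_and, not_le]
    constructor
    · rintro ⟨⟨h1, h2⟩, h3⟩
      exact ⟨h3 h1, h2⟩
    · rintro ⟨h1, h2⟩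
      exact ⟨⟨by linarith, h2⟩, fun _ => h1⟩
  have h1 : μ.real (Ioc a b) = 0 := by
    rw [← hdiff, measureReal_sdiff (Icc_subset_Icc_right hab) measurableSet_Icc,
      hconst a ⟨ha1, ha2.trans hx.2⟩, hconst b ⟨hx.1.trans hb1, hb2⟩, sub_self]
  exact (measureReal_eq_zero_iff).1 h1

/-! ### The coincidence set -/

variable {ξ : ℝ → ℝ} {R h : ℝ} {μ : Measure ℝ} {e e1 : ℝ → ℝ}

/-- If `ξ'' A² = 1` for an affine `A`, then `1/√ξ'' = |A|`, which is affine near every point since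
`A` has no zero. -/
lemma dfrak_eq_zero_of_mul_sq (hξ : IsCovariance ξ R) {c m : ℝ}
    (h1 : ∀ t ∈ Metric.ball (0 : ℝ) R, iteratedDeriv 2 ξ t * (c - m * t) ^ 2 = 1) :
    ∀ t ∈ Ioo (0 : ℝ) 1, dfrak ξ t = 0 := by
  intro t ht
  have htb : t ∈ Metric.ball (0 : ℝ) R := hξ.mem_ball (Ioo_subset_Icc_self ht)
  have habs : ∀ s ∈ Metric.ball (0 : ℝ) R, 1 / √(iteratedDeriv 2 ξ s) = |c - m * s| := fun s hs => by
    have hne : c - m * s ≠ 0 := fun h0 => by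
      have := h1 s hs
      rw [h0] at this
      norm_num at this
    have h2 : iteratedDeriv 2 ξ s = 1 / (c - m * s) ^ 2 := by
      rw [eq_div_iff (pow_ne_zero 2 hne), h1 s hs]
    rw [h2, Real.sqrt_div zero_le_one, Real.sqrt_one, Real.sqrt_sq_eq_abs, one_div_one_div]
  have hne : c - m * t ≠ 0 := fun h0 => by
    have := h1 t htb
    rw [h0] at this
    norm_num at this
  have haff : ∀ a b : ℝ, iteratedDeriv 2 (fun s => a + b * s) t = 0 := fun a b => by
    have h3 : deriv (fun s : ℝ => a + b * s) = fun _ => b := by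
      ext s
      simp
    rw [iteratedDeriv_succ, iteratedDeriv_one, h3, deriv_const]
  have hball : ∀ᶠ s in 𝓝 t, s ∈ Metric.ball (0 : ℝ) R := Metric.isOpen_ball.mem_nhds htb
  have hcont : ContinuousAt (fun s => c - m * s) t := by fun_prop
  rw [dfrak]
  rcases lt_or_gt_of_ne hne with hlt | hgt
  · rw [← haff (-c) m]
    refine Filter.EventuallyEq.iteratedDeriv_eq 2 ?_
    filter_upwards [hball, hcont.eventually_lt continuousAt_const hlt] with s hs hs'
    rw [habs s hs, abs_of_neg hs']
    ring
  · rw [← haff c (-m)]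
    refine Filter.EventuallyEq.iteratedDeriv_eq 2 ?_
    filter_upwards [hball, continuousAt_const.eventually_lt hcont hgt] with s hs hs'
    rw [habs s hs, abs_of_pos hs']
    ring

namespace IsCertificate

lemma hasDerivAt_sub (he : IsCertificate ξ h μ e e1) (hξ : IsCovariance ξ R) {t : ℝ}
    (ht : t ∈ Ico (0 : ℝ) 1) : HasDerivAt (fun s => e s - ξ s) (e1 t - deriv ξ t) t :=
  (he.hasDerivAt t ht.2).sub (hξ.hasDerivAt ⟨ht.1, ht.2.le⟩)

lemma hasDerivAt_deriv_sub (he : IsCertificate ξ h μ e e1) (hξ : IsCovariance ξ R) {t : ℝ}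
    (ht : t ∈ Ico (0 : ℝ) 1) : HasDerivAt (fun s => e1 s - deriv ξ s)
      (1 / phi μ t ^ 2 - iteratedDeriv 2 ξ t) t :=
  (he.hasDerivAt_deriv t ht.2).sub (hξ.hasDerivAt_deriv ⟨ht.1, ht.2.le⟩)

/-- At a contact point the derivatives agree. At the endpoint `0` this uses `e'(0) = -h² ≤ 0`. -/
lemma deriv_eq_of_coincidence (he : IsCertificate ξ h μ e e1) (hξ : IsCovariance ξ R) {t : ℝ}
    (ht : t ∈ coincidence ξ e) : e1 t - deriv ξ t = 0 := by
  have hd := he.hasDerivAt_sub hξ ht.1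
  have hmin : ∀ s ∈ Ico (0 : ℝ) 1, e t - ξ t ≤ e s - ξ s := fun s hs => by
    rw [ht.2, sub_self]
    exact sub_nonneg.2 (he.le s hs)
  rcases eq_or_lt_of_le ht.1.1 with h0 | h0
  · subst h0
    refine le_antisymm ?_ ?_
    · rw [he.deriv_zero, hξ.deriv_zero]
      nlinarith [sq_nonneg h]
    · have h1 : Filter.Tendsto (slope (fun s => e s - ξ s) 0) (𝓝[>] 0) (𝓝 (e1 0 - deriv ξ 0)) :=
        hd.tendsto_slope.mono_left (nhdsGT_le_nhdsNE 0)
      have h2 : ∀ᶠ s in 𝓝[>] (0 : ℝ), 0 ≤ slope (fun s => e s - ξ s) 0 s := by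
        filter_upwards [Ioo_mem_nhdsGT (zero_lt_one (α := ℝ))] with s hs
        rw [slope_def_field]
        exact div_nonneg (sub_nonneg.2 (hmin s ⟨hs.1.le, hs.2⟩)) (by linarith [hs.1])
      exact ge_of_tendsto h1 h2
  · refine IsLocalMin.hasDerivAt_eq_zero ?_ hd
    filter_upwards [Ico_mem_nhds h0 ht.1.2] with s hs using hmin s hs

/-- Between two contact points there is a point where `1/φ² = ξ''`. -/
lemma exists_second_deriv_eq (he : IsCertificate ξ h μ e e1) (hξ : IsCovariance ξ R) {s t : ℝ}
    (hs : 0 ≤ s) (ht : t < 1) (hst : s < t) (hs0 : e1 s - deriv ξ s = 0)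
    (ht0 : e1 t - deriv ξ t = 0) :
    ∃ y ∈ Ioo s t, 1 / phi μ y ^ 2 - iteratedDeriv 2 ξ y = 0 := by
  have hd : ∀ x ∈ Icc s t, x ∈ Ico (0 : ℝ) 1 := fun x hx => ⟨hs.trans hx.1, hx.2.trans_lt ht⟩
  refine exists_hasDerivAt_eq_zero hst (f := fun s => e1 s - deriv ξ s)
    (fun x hx => (he.hasDerivAt_deriv_sub hξ (hd x hx)).continuousAt.continuousWithinAt)
    (by simp only [hs0, ht0])
    (fun x hx => he.hasDerivAt_deriv_sub hξ (hd x (Ioo_subset_Icc_self hx)))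

/-- If contact points accumulate at `x` along an interval without mass, then by Rolle's theorem and
analyticity `1/√ξ''` is affine. -/
lemma dfrak_eq_zero_of_mem_closure (he : IsCertificate ξ h μ e e1) (hξ : IsCovariance ξ R)
    (hμ : μ ∈ prUnit) (hφ : ∀ s < 1, 0 < phi μ s) {u v x : ℝ} (huv : u < v)
    (hnull : μ (Ioo u v) = 0) (hx : x ∈ Ico (0 : ℝ) 1) (hxI : x ∉ Ioo u v)
    (hcl : x ∈ closure (coincidence ξ e ∩ Ioo u v)) : ∀ t ∈ Ioo (0 : ℝ) 1, dfrak ξ t = 0 := by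
  have := hμ.1
  obtain ⟨c, m, hA⟩ := exists_phi_eq_affine huv hnull
  have hfreq : ∃ᶠ y in 𝓝[≠] x, iteratedDeriv 2 ξ y * (c - m * y) ^ 2 - 1 = 0 := by
    rw [frequently_nhdsWithin_iff, Filter.frequently_iff]
    intro N hN
    obtain ⟨δ, hδ, hδN⟩ := Metric.mem_nhds_iff.1 hN
    obtain ⟨y₁, hy₁, hy₁S, hy₁I⟩ := mem_closure_iff_nhds.1 hcl _ (Metric.ball_mem_nhds x hδ)
    have hne : y₁ ≠ x := fun h => hxI (h ▸ hy₁I)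
    obtain ⟨y₂, ⟨hy₂, hy₂'⟩, hy₂S, hy₂I⟩ := mem_closure_iff_nhds.1 hcl _
      (Filter.inter_mem (Metric.ball_mem_nhds x hδ) (isOpen_ne.mem_nhds hne.symm))
    have key : ∀ {s t : ℝ}, s < t → s ∈ Metric.ball x δ → t ∈ Metric.ball x δ → s ∈ Ioo u v →
        t ∈ Ioo u v → s ∈ coincidence ξ e → t ∈ coincidence ξ e →
        ∃ y ∈ N, iteratedDeriv 2 ξ y * (c - m * y) ^ 2 - 1 = 0 ∧ y ∈ ({x}ᶜ : Set ℝ) := by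
      intro s t hst hs ht hsI htI hsS htS
      obtain ⟨y, hy, hy0⟩ := he.exists_second_deriv_eq hξ hsS.1.1 htS.1.2 hst
        (he.deriv_eq_of_coincidence hξ hsS) (he.deriv_eq_of_coincidence hξ htS)
      have hyI : y ∈ Ioo u v := ⟨hsI.1.trans hy.1, hy.2.trans htI.2⟩
      have hyB : y ∈ Metric.ball x δ := by
        rw [Real.ball_eq_Ioo] at hs ht ⊢
        exact ⟨hs.1.trans hy.1, hy.2.trans ht.2⟩
      refine ⟨y, hδN hyB, ?_, fun h => hxI (h ▸ hyI)⟩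
      have hp := hφ y (hy.2.trans htS.1.2)
      rw [hA y (Ioo_subset_Icc_self hyI)] at hy0 hp
      rw [← sub_eq_zero.1 hy0]
      field_simp
      simp
    rcases lt_or_gt_of_ne hy₂' with hlt | hgt
    · exact key hlt hy₂ hy₁ hy₂I hy₁I hy₂S hy₁S
    · exact key hgt hy₁ hy₂ hy₁I hy₂I hy₁S hy₂S
  have han : AnalyticOnNhd ℝ (fun y => iteratedDeriv 2 ξ y * (c - m * y) ^ 2 - 1)
      (Metric.ball 0 R) := by
    refine (hξ.analytic_deriv2.mul (AnalyticOnNhd.pow ?_ 2)).sub analyticOnNhd_const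
    exact analyticOnNhd_const.sub (analyticOnNhd_const.mul analyticOnNhd_id)
  have hzero := han.eqOn_zero_of_preconnected_of_frequently_eq_zero
    (convex_ball 0 R).isPreconnected (hξ.mem_ball (Ico_subset_Icc_self hx)) hfreq
  exact dfrak_eq_zero_of_mul_sq hξ fun t ht => sub_eq_zero.1 (hzero ht)

theorem isolated_of_notMem_support (he : IsCertificate ξ h μ e e1) (hξ : IsCovariance ξ R)
    (hμ : μ ∈ prUnit) (hφ : ∀ s < 1, 0 < phi μ s) (hd : ∃ t ∈ Ioo (0 : ℝ) 1, dfrak ξ t ≠ 0)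
    {x : ℝ} (hx : x ∈ coincidence ξ e \ μ.support) :
    ∃ U ∈ 𝓝 x, U ∩ coincidence ξ e = {x} := by
  obtain ⟨V, hV, hV0⟩ := Measure.notMem_support_iff_exists.1 hx.2
  obtain ⟨δ, hδ, hδV⟩ := Metric.mem_nhds_iff.1 hV
  rw [Real.ball_eq_Ioo] at hδV
  obtain ⟨t, ht, htd⟩ := hd
  have hl : x ∉ closure (coincidence ξ e ∩ Ioo (x - δ) x) := fun hcl =>
    htd (he.dfrak_eq_zero_of_mem_closure hξ hμ hφ (by linarith)
      (measure_mono_null ((Ioo_subset_Ioo_right (by linarith)).trans hδV) hV0) hx.1.1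
      (fun h => h.2.false) hcl t ht)
  have hr : x ∉ closure (coincidence ξ e ∩ Ioo x (x + δ)) := fun hcl =>
    htd (he.dfrak_eq_zero_of_mem_closure hξ hμ hφ (by linarith)
      (measure_mono_null ((Ioo_subset_Ioo_left (by linarith)).trans hδV) hV0) hx.1.1
      (fun h => h.1.false) hcl t ht)
  refine ⟨Ioo (x - δ) (x + δ) ∩ ((closure (coincidence ξ e ∩ Ioo (x - δ) x))ᶜ ∩
    (closure (coincidence ξ e ∩ Ioo x (x + δ)))ᶜ), ?_, ?_⟩
  · exact Filter.inter_mem (Ioo_mem_nhds (by linarith) (by linarith))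
      (Filter.inter_mem (isClosed_closure.isOpen_compl.mem_nhds hl)
        (isClosed_closure.isOpen_compl.mem_nhds hr))
  · refine Subset.antisymm ?_ ?_
    · rintro y ⟨⟨hy, hyl, hyr⟩, hyS⟩
      by_contra hne
      rcases lt_or_gt_of_ne (show y ≠ x from hne) with hlt | hgt
      · exact hyl (subset_closure ⟨hyS, hy.1, hlt⟩)
      · exact hyr (subset_closure ⟨hyS, hgt, hy.2⟩)
    · rintro y rfl
      exact ⟨⟨⟨by linarith, by linarith⟩, hl, hr⟩, hx.1⟩

end IsCertificate

/-! ### The degenerate case -/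

lemma exists_affine_of_dfrak_eq_zero (hξ : IsCovariance ξ R)
    (hd : ∀ t ∈ Ioo (0 : ℝ) 1, dfrak ξ t = 0) :
    ∃ c m : ℝ, ∀ t ∈ Ioo (0 : ℝ) 1, 0 < c - m * t ∧ iteratedDeriv 2 ξ t = 1 / (c - m * t) ^ 2 := by
  set g : ℝ → ℝ := fun t => 1 / √(iteratedDeriv 2 ξ t) with hg
  have hcd : ∀ t ∈ Ioo (0 : ℝ) 1, ContDiffAt ℝ 2 g t := fun t ht => by
    have h1 : ContDiffAt ℝ 2 (iteratedDeriv 2 ξ) t :=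
      (hξ.analytic_deriv2 t (hξ.mem_ball (Ioo_subset_Icc_self ht))).contDiffAt
    exact contDiffAt_const.div (h1.sqrt (hξ.pos t ht).ne') (Real.sqrt_pos.2 (hξ.pos t ht)).ne'
  have hcdo : ContDiffOn ℝ 2 g (Ioo 0 1) := fun t ht => (hcd t ht).contDiffWithinAt
  have hdiff : DifferentiableOn ℝ (deriv g) (Ioo 0 1) :=
    (hcdo.deriv_of_isOpen (m := 1) isOpen_Ioo (by norm_num)).differentiableOn one_ne_zero
  have hd2 : EqOn (deriv (deriv g)) 0 (Ioo 0 1) := fun t ht => by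
    have := hd t ht
    rwa [dfrak, iteratedDeriv_succ, iteratedDeriv_one] at this
  obtain ⟨a, ha⟩ := isOpen_Ioo.exists_is_const_of_deriv_eq_zero isPreconnected_Ioo hdiff hd2
  have hgd : DifferentiableOn ℝ g (Ioo 0 1) := hcdo.differentiableOn two_ne_zero
  have hd1 : EqOn (deriv fun t => g t - a * t) 0 (Ioo 0 1) := fun t ht => by
    have h1 := (hgd.differentiableAt (isOpen_Ioo.mem_nhds ht)).hasDerivAt.fun_sub
      ((hasDerivAt_id' t).const_mul a)
    rw [h1.deriv, ha t ht]
    simp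
  obtain ⟨c, hc⟩ := isOpen_Ioo.exists_is_const_of_deriv_eq_zero isPreconnected_Ioo
    (hgd.fun_sub ((by fun_prop))) hd1
  refine ⟨c, -a, fun t ht => ?_⟩
  have hgt : c - -a * t = g t := by
    rw [← hc t ht]; ring
  have hpos := hξ.pos t ht
  have hsq := Real.sqrt_pos.2 hpos
  rw [hgt]
  refine ⟨by simp only [hg]; positivity, ?_⟩
  simp only [hg]
  rw [div_pow, one_pow, Real.sq_sqrt hpos.le, one_div_one_div]

namespace IsCertificate

/-- When `1/√ξ''` is affine the coincidence set has no gaps: `φ_μ` is affine on a gap, and it agrees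
with `1/√ξ''` at two points of the gap by Rolle's theorem. -/
lemma Icc_subset_coincidence (he : IsCertificate ξ h μ e e1) (hξ : IsCovariance ξ R)
    (hμ : μ ∈ prUnit) (hφ : ∀ s < 1, 0 < phi μ s) {c m : ℝ}
    (hA : ∀ t ∈ Ioo (0 : ℝ) 1, 0 < c - m * t ∧ iteratedDeriv 2 ξ t = 1 / (c - m * t) ^ 2)
    {u v : ℝ} (hu : u ∈ coincidence ξ e) (hv : v ∈ coincidence ξ e) :
    Icc u v ⊆ coincidence ξ e := by
  have := hμ.1
  intro w hw
  have hw01 : w ∈ Ico (0 : ℝ) 1 := ⟨hu.1.1.trans hw.1, hw.2.trans_lt hv.1.2⟩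
  by_contra hwS
  have hcont : ContinuousOn (fun s => e s - ξ s) (Icc u v) := fun t ht =>
    (he.hasDerivAt_sub hξ ⟨hu.1.1.trans ht.1, ht.2.trans_lt hv.1.2⟩).continuousAt.continuousWithinAt
  have hcomp : ∀ {a b : ℝ}, Icc a b ⊆ Icc u v →
      IsCompact (Icc a b ∩ (fun s => e s - ξ s) ⁻¹' {0}) := fun hab =>
    isCompact_Icc.of_isClosed_subset
      ((hcont.mono hab).preimage_isClosed_of_isClosed isClosed_Icc isClosed_singleton)
      inter_subset_left
  have hmemS : ∀ {t : ℝ}, t ∈ Icc u v → e t - ξ t = 0 → t ∈ coincidence ξ e := fun ht h0 =>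
    ⟨⟨hu.1.1.trans ht.1, ht.2.trans_lt hv.1.2⟩, sub_eq_zero.1 h0⟩
  -- The endpoints `a`, `b` of the gap that contains `w`.
  obtain ⟨a, ⟨haI, ha0⟩, haub⟩ := (hcomp (Icc_subset_Icc_right hw.2)).exists_isGreatest
    ⟨u, ⟨le_rfl, hw.1⟩, sub_eq_zero.2 hu.2⟩
  obtain ⟨b, ⟨hbI, hb0⟩, hblb⟩ := (hcomp (Icc_subset_Icc_left hw.1)).exists_isLeast
    ⟨v, ⟨hw.2, le_rfl⟩, sub_eq_zero.2 hv.2⟩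
  have haS := hmemS ⟨haI.1, haI.2.trans hw.2⟩ ha0
  have hbS := hmemS ⟨hw.1.trans hbI.1, hbI.2⟩ hb0
  have haw : a < w := lt_of_le_of_ne haI.2 fun h => hwS (h ▸ haS)
  have hwb : w < b := lt_of_le_of_ne hbI.1 fun h => hwS (h ▸ hbS)
  have hgap : ∀ t ∈ Ioo a b, e t ≠ ξ t := fun t ht h0 => by
    rcases le_total t w with h1 | h1
    · exact ht.1.not_ge (haub ⟨⟨haI.1.trans ht.1.le, h1⟩, sub_eq_zero.2 h0⟩)
    · exact ht.2.not_ge (hblb ⟨⟨h1, ht.2.le.trans hbI.2⟩, sub_eq_zero.2 h0⟩)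
  have hnull : μ (Ioo a b) = 0 := measure_mono_null (fun t ht => hgap t ht) he.ae_eq
  obtain ⟨c', m', hA'⟩ := exists_phi_eq_affine (haw.trans hwb) hnull
  have ha := haS.1
  have hb := hbS.1
  have hda := he.deriv_eq_of_coincidence hξ haS
  have hdb := he.deriv_eq_of_coincidence hξ hbS
  have h01 : ∀ t ∈ Icc a b, t ∈ Ico (0 : ℝ) 1 := fun t ht =>
    ⟨ha.1.trans ht.1, ht.2.trans_lt hb.2⟩
  obtain ⟨z, hz, hz0⟩ := exists_hasDerivAt_eq_zero (haw.trans hwb) (f := fun s => e s - ξ s)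
    (fun t ht => (he.hasDerivAt_sub hξ (h01 t ht)).continuousAt.continuousWithinAt)
    (show e a - ξ a = e b - ξ b from ha0.trans hb0.symm)
    (fun t ht => he.hasDerivAt_sub hξ (h01 t (Ioo_subset_Icc_self ht)))
  have hz01 := h01 z (Ioo_subset_Icc_self hz)
  obtain ⟨y₁, hy₁, hy₁0⟩ := he.exists_second_deriv_eq hξ ha.1 hz01.2 hz.1 hda hz0
  obtain ⟨y₂, hy₂, hy₂0⟩ := he.exists_second_deriv_eq hξ hz01.1 hb.2 hz.2 hz0 hdb
  have hval : ∀ y ∈ Ioo a b, 1 / phi μ y ^ 2 - iteratedDeriv 2 ξ y = 0 →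
      c' - m' * y = c - m * y := fun y hy hy0 => by
    have hy01 : y ∈ Ioo (0 : ℝ) 1 := ⟨ha.1.trans_lt hy.1, hy.2.trans hb.2⟩
    obtain ⟨hpos, hval⟩ := hA y hy01
    have hp := hφ y hy01.2
    rw [← hA' y (Ioo_subset_Icc_self hy)]
    rw [hval, sub_eq_zero, one_div, one_div, inv_inj] at hy0
    exact (pow_left_inj₀ hp.le hpos.le two_ne_zero).1 hy0
  have e₁ := hval y₁ ⟨hy₁.1, hy₁.2.trans hz.2⟩ hy₁0
  have e₂ := hval y₂ ⟨hz.1.trans hy₂.1, hy₂.2⟩ hy₂0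
  have hm : m' = m := by
    have h1 : (m' - m) * (y₂ - y₁) = 0 := by linarith
    rcases mul_eq_zero.1 h1 with h2 | h2
    · linarith
    · linarith [hy₁.2, hy₂.1]
  have hc : c' = c := by rw [hm] at e₁; linarith
  have hsecond : ∀ t ∈ Ioo a b, 1 / phi μ t ^ 2 - iteratedDeriv 2 ξ t = 0 := fun t ht => by
    rw [hA' t (Ioo_subset_Icc_self ht), hc, hm, (hA t ⟨ha.1.trans_lt ht.1, ht.2.trans hb.2⟩).2,
      sub_self]
  -- Hence `e - ξ`, which vanishes to first order at `a`, vanishes on the gap.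
  have hfirst : ∀ t ∈ Ioo a b, e1 t - deriv ξ t = 0 := fun t ht => by
    obtain ⟨y, hy, hy0⟩ := exists_hasDerivAt_eq_slope (fun s => e1 s - deriv ξ s) _ ht.1
      (fun s hs => (he.hasDerivAt_deriv_sub hξ
        (h01 s ⟨hs.1, hs.2.trans ht.2.le⟩)).continuousAt.continuousWithinAt)
      (fun s hs => he.hasDerivAt_deriv_sub hξ (h01 s ⟨hs.1.le, (hs.2.trans ht.2).le⟩))
    rw [hsecond y ⟨hy.1, hy.2.trans ht.2⟩, eq_comm, div_eq_zero_iff] at hy0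
    rcases hy0 with h1 | h1
    · linarith
    · linarith [ht.1]
  obtain ⟨y, hy, hy0⟩ := exists_hasDerivAt_eq_slope (fun s => e s - ξ s) _ haw
    (fun s hs => (he.hasDerivAt_sub hξ
      (h01 s ⟨hs.1, hs.2.trans hwb.le⟩)).continuousAt.continuousWithinAt)
    (fun s hs => he.hasDerivAt_sub hξ (h01 s ⟨hs.1.le, (hs.2.trans hwb).le⟩))
  rw [hfirst y ⟨hy.1, hy.2.trans hwb⟩, eq_comm, div_eq_zero_iff] at hy0
  have ha0' : e a - ξ a = 0 := ha0
  rcases hy0 with h1 | h1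
  · exact hgap w ⟨haw, hwb⟩ (by linarith)
  · linarith

/-- In the interior of the coincidence set `φ_μ` is `1/√ξ''`. -/
lemma second_deriv_eq_of_Ioo_subset (he : IsCertificate ξ h μ e e1) (hξ : IsCovariance ξ R)
    {u v : ℝ} (huv : Ioo u v ⊆ coincidence ξ e) {t : ℝ} (ht : t ∈ Ioo u v) :
    1 / phi μ t ^ 2 = iteratedDeriv 2 ξ t := by
  have h1 := he.hasDerivAt_deriv_sub hξ (huv ht).1
  have h2 : (fun s => e1 s - deriv ξ s) =ᶠ[𝓝 t] fun _ => 0 := by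
    filter_upwards [isOpen_Ioo.mem_nhds ht] with s hs
      using he.deriv_eq_of_coincidence hξ (huv hs)
  have h3 := (h1.congr_of_eventuallyEq h2.symm).unique (hasDerivAt_const t 0)
  exact sub_eq_zero.1 h3

/-- When `1/√ξ''` is affine the coincidence set is a compact interval. It stays away from `1`, as
`φ_μ = 1/√ξ''` is impossible near `1`, where `φ_μ(s) ≤ 1 - s`. -/
lemma exists_coincidence_eq_Icc (he : IsCertificate ξ h μ e e1) (hξ : IsCovariance ξ R)
    (hμ : μ ∈ prUnit) (hφ : ∀ s < 1, 0 < phi μ s) {Q : ℝ} (hQ1 : Q < 1) (hQ : μ (Ioi Q) = 0)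
    {c m : ℝ}
    (hA : ∀ t ∈ Ioo (0 : ℝ) 1, 0 < c - m * t ∧ iteratedDeriv 2 ξ t = 1 / (c - m * t) ^ 2) :
    ∃ r₁ r₂ : ℝ, 0 ≤ r₁ ∧ r₁ ≤ r₂ ∧ r₂ < 1 ∧ coincidence ξ e = Icc r₁ r₂ := by
  have := hμ.1
  have hS : ∀ᵐ r ∂μ, r ∈ coincidence ξ e := by
    filter_upwards [he.ae_eq, ae_mem_Icc hμ hQ] with r hr hr' using
      ⟨⟨hr'.1, hr'.2.trans_lt hQ1⟩, hr⟩
  obtain ⟨s₀, hs₀⟩ := hS.exists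
  have hbdd : ∃ q < 1, ∀ s ∈ coincidence ξ e, s ≤ q := by
    by_contra! hcon
    have hsub : Ioo s₀ 1 ⊆ coincidence ξ e := fun t ht => by
      obtain ⟨s, hs, hst⟩ := hcon t ht.2
      exact he.Icc_subset_coincidence hξ hμ hφ hA hs₀ hs ⟨ht.1.le, hst.le⟩
    obtain ⟨C, hC⟩ := isCompact_Icc.exists_bound_of_continuousOn hξ.continuousOn_deriv2
    have hC0 : 0 ≤ C := (norm_nonneg _).trans (hC 0 (left_mem_Icc.2 zero_le_one))
    set τ := 1 / (C + 2) with hτ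
    have hτ0 : 0 < τ := by positivity
    set t := max ((s₀ + 1) / 2) (1 - τ) with ht
    have ht1 : t < 1 := max_lt (by linarith [hs₀.1.2]) (by linarith)
    have hts : s₀ < t := lt_of_lt_of_le (by linarith [hs₀.1.2]) (le_max_left _ _)
    have htτ : 1 - t ≤ τ := by linarith [le_max_right ((s₀ + 1) / 2) (1 - τ)]
    have h1 := he.second_deriv_eq_of_Ioo_subset hξ hsub ⟨hts, ht1⟩
    have hp := hφ t ht1
    have hpτ : phi μ t ≤ τ := (phi_le μ ht1.le).trans htτ
    have h2 := (Real.le_norm_self _).trans (hC t ⟨(hs₀.1.1.trans_lt hts).le, ht1.le⟩)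
    rw [← h1, div_le_iff₀ (pow_pos hp 2)] at h2
    have h3 : C * phi μ t ^ 2 ≤ C * τ ^ 2 := by gcongr
    have h4 : (C + 2) * τ = 1 := by rw [hτ]; field_simp
    have h5 : τ ≤ 1 := by rw [hτ, div_le_one (by linarith)]; linarith
    nlinarith
  obtain ⟨q, hq1, hq⟩ := hbdd
  have hSeq : coincidence ξ e = Icc 0 q ∩ (fun s => e s - ξ s) ⁻¹' {0} := by
    ext t
    constructor
    · exact fun ht => ⟨⟨ht.1.1, hq t ht⟩, sub_eq_zero.2 ht.2⟩
    · exact fun ht => ⟨⟨ht.1.1, ht.1.2.trans_lt hq1⟩, sub_eq_zero.1 ht.2⟩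
  have hcomp : IsCompact (coincidence ξ e) := by
    rw [hSeq]
    refine isCompact_Icc.of_isClosed_subset
      (ContinuousOn.preimage_isClosed_of_isClosed (fun t ht => ?_) isClosed_Icc
        isClosed_singleton) inter_subset_left
    exact (he.hasDerivAt_sub hξ ⟨ht.1, ht.2.trans_lt hq1⟩).continuousAt.continuousWithinAt
  obtain ⟨r₁, hr₁, hlb⟩ := hcomp.exists_isLeast ⟨s₀, hs₀⟩
  obtain ⟨r₂, hr₂, hub⟩ := hcomp.exists_isGreatest ⟨s₀, hs₀⟩
  exact ⟨r₁, r₂, hr₁.1.1, hlb hr₂, hr₂.1.2, Subset.antisymm (fun t ht => ⟨hlb ht, hub ht⟩)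
    (he.Icc_subset_coincidence hξ hμ hφ hA hr₁ hr₂)⟩

end IsCertificate

lemma eq_dirac_add_dirac {μ : Measure ℝ} [IsProbabilityMeasure μ] {r₁ r₂ : ℝ}
    (hae : ∀ᵐ x ∂μ, x ∈ ({r₁, r₂} : Set ℝ)) :
    ∃ m ∈ Icc (0 : ℝ) 1,
      μ = ENNReal.ofReal m • Measure.dirac r₁ + ENNReal.ofReal (1 - m) • Measure.dirac r₂ := by
  have hres := Measure.restrict_eq_self_of_ae_mem hae
  rcases eq_or_ne r₁ r₂ with rfl | hne
  · refine ⟨1, by simp, ?_⟩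
    rw [pair_eq_singleton] at hres hae
    have h1 : μ {r₁} = 1 := (mem_ae_iff_prob_eq_one (measurableSet_singleton r₁)).1 hae
    rw [Measure.restrict_singleton, h1] at hres
    simpa using hres.symm
  · have hdisj : Disjoint ({r₁} : Set ℝ) {r₂} := by simpa using hne
    have h1 : μ {r₁} + μ {r₂} = 1 := by
      rw [← measure_union hdisj (measurableSet_singleton r₂)]
      exact (mem_ae_iff_prob_eq_one ((measurableSet_singleton r₁).union
        (measurableSet_singleton r₂))).1 hae
    refine ⟨μ.real {r₁}, ⟨measureReal_nonneg, measureReal_le_one⟩, ?_⟩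
    have h2 : ENNReal.ofReal (1 - μ.real {r₁}) = μ {r₂} := by
      rw [ENNReal.ofReal_sub _ measureReal_nonneg, ENNReal.ofReal_one, ofReal_measureReal, ← h1,
        ENNReal.add_sub_cancel_left (measure_ne_top μ _)]
    rw [h2, ofReal_measureReal, ← Measure.restrict_singleton, ← Measure.restrict_singleton,
      ← Measure.restrict_union hdisj (measurableSet_singleton r₂)]
    exact hres.symm

theorem IsCertificate.eq_two_atoms (he : IsCertificate ξ h μ e e1) (hξ : IsCovariance ξ R)
    (hμ : μ ∈ prUnit) (hφ : ∀ s < 1, 0 < phi μ s) {Q : ℝ} (hQ1 : Q < 1) (hQ : μ (Ioi Q) = 0)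
    (hd : ∀ t ∈ Ioo (0 : ℝ) 1, dfrak ξ t = 0) :
    ∃ m ∈ Icc (0 : ℝ) 1, ∃ r₁ ∈ Icc (0 : ℝ) 1, ∃ r₂ ∈ Icc (0 : ℝ) 1, r₁ ≤ r₂ ∧
      μ = ENNReal.ofReal m • Measure.dirac r₁ + ENNReal.ofReal (1 - m) • Measure.dirac r₂ ∧
      coincidence ξ e = Icc r₁ r₂ := by
  have := hμ.1
  obtain ⟨c, m, hA⟩ := exists_affine_of_dfrak_eq_zero hξ hd
  obtain ⟨r₁, r₂, h0, h12, h1, hS⟩ := he.exists_coincidence_eq_Icc hξ hμ hφ hQ1 hQ hA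
  have hnull : μ (Ioo r₁ r₂) = 0 := by
    refine measure_Ioo_eq_zero_of_affine (c := c) (m := m) h0 fun s hs => ?_
    have hs01 : s ∈ Ioo (0 : ℝ) 1 := ⟨h0.trans_lt hs.1, hs.2.trans h1⟩
    have h2 := he.second_deriv_eq_of_Ioo_subset hξ (hS ▸ Ioo_subset_Icc_self) hs
    obtain ⟨hpos, hval⟩ := hA s hs01
    rw [hval, one_div, one_div, inv_inj] at h2
    exact (pow_left_inj₀ (hφ s hs01.2).le hpos.le two_ne_zero).1 h2
  have hae : ∀ᵐ x ∂μ, x ∈ ({r₁, r₂} : Set ℝ) := by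
    filter_upwards [he.ae_eq, ae_mem_Icc hμ hQ, measure_eq_zero_iff_ae_notMem.1 hnull]
      with x hx hxQ hxn
    have hxS : x ∈ Icc r₁ r₂ := hS ▸ (⟨⟨hxQ.1, hxQ.2.trans_lt hQ1⟩, hx⟩ : x ∈ coincidence ξ e)
    rcases eq_or_lt_of_le hxS.1 with h | h
    · exact Or.inl h.symm
    · rcases eq_or_lt_of_le hxS.2 with h' | h'
      · exact Or.inr h'
      · exact absurd ⟨h, h'⟩ hxn
  obtain ⟨m', hm', hμeq⟩ := eq_dirac_add_dirac hae
  exact ⟨m', hm', r₁, ⟨h0, h12.trans h1.le⟩, r₂, ⟨h0.trans h12, h1.le⟩, h12, hμeq, hS⟩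

end

end CrisantiSommers

theorem mainTheorem5 (β : ℝ) (b : ℕ → ℝ) (h : ℝ)
    (hβ : β ≠ 0) (hb : ∃ p, 2 ≤ p ∧ b p ≠ 0)
    (hsum : ∃ ε : ℝ, 0 < ε ∧ Summable fun k : ℕ => (b (k + 2)) ^ 2 * (1 + ε) ^ (k + 2))
    (hh : 0 ≤ h)
    (μ : Measure ℝ) (hμ : μ ∈ CrisantiSommers.prUnit)
    (hmin : IsMinOn (CrisantiSommers.primal (CrisantiSommers.xi β b) h) CrisantiSommers.prUnit μ)
    (η : ℝ → ℝ) (hη : η ∈ CrisantiSommers.admissible (CrisantiSommers.xi β b) h)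
    (hmax : IsMaxOn (CrisantiSommers.dual (CrisantiSommers.xi β b) h)
      (CrisantiSommers.admissible (CrisantiSommers.xi β b) h) η) :
    ((∃ t ∈ Ioo (0 : ℝ) 1, CrisantiSommers.dfrak (CrisantiSommers.xi β b) t ≠ 0) →
      ∀ x ∈ CrisantiSommers.coincidence (CrisantiSommers.xi β b) η \ μ.support,
        ∃ U ∈ 𝓝 x, U ∩ CrisantiSommers.coincidence (CrisantiSommers.xi β b) η = {x}) ∧
    ((∀ t ∈ Ioo (0 : ℝ) 1, CrisantiSommers.dfrak (CrisantiSommers.xi β b) t = 0) →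
      ∃ m ∈ Icc (0 : ℝ) 1, ∃ r₁ ∈ Icc (0 : ℝ) 1, ∃ r₂ ∈ Icc (0 : ℝ) 1, r₁ ≤ r₂ ∧
        μ = ENNReal.ofReal m • Measure.dirac r₁ + ENNReal.ofReal (1 - m) • Measure.dirac r₂ ∧
        CrisantiSommers.coincidence (CrisantiSommers.xi β b) η = Icc r₁ r₂) := by
  obtain ⟨ε, hε, hs⟩ := hsum
  have hξ := CrisantiSommers.isCovariance_xi hβ hb hε hs
  obtain ⟨Q, hQ0, hQ1, hQ⟩ := CrisantiSommers.exists_measure_Ioi_eq_zero hξ hμ hmin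
  have hφ : ∀ s < 1, 0 < CrisantiSommers.phi μ s := fun s hs =>
    CrisantiSommers.phi_pos_of_measure_Ioi hμ hQ hQ1 hs
  obtain ⟨e, e1, he⟩ := CrisantiSommers.exists_isCertificate hξ hμ hmin hQ0 hQ1 hQ
  have heq := he.eqOn_of_isMaxOn hμ hQ0 hQ1 hQ hη hmax
  have hS : CrisantiSommers.coincidence (CrisantiSommers.xi β b) η
      = CrisantiSommers.coincidence (CrisantiSommers.xi β b) e := by
    ext t
    exact and_congr_right fun ht => by rw [heq ht]
  rw [hS]
  exact ⟨fun hd x hx => he.isolated_of_notMem_support hξ hμ hφ hd hx,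
    fun hd => he.eq_two_atoms hξ hμ hφ hQ1 hQ hd⟩
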